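/- Let $V$ be a finite set, and for each $v\in V$ let $\mathcal X_v$ be a finite set with at least two elements. For $S\subseteq V$ write $\mathcal X_S=\prod_{v\in S}\mathcal X_v$ and $X_S=(X_v)_{v\in S}$. Let $G$ be either (a) an undirected graph on $V$; a probability distribution $\mathbb P$ on $\mathcal X_V$ *factorizes on* $G$ if there are a collection $\mathcal C$ of cliques of $G$, maps $\psi_K:\mathcal X_K\to[0,\infty)$ for $K\in\mathcal C$, and a constant $Z>0$ with $\mathbb P(X_V=x)=\frac1Z\prod_{K\in\mathcal C}\psi_K(x_K)$ for all $x$; or (b) an acyclic directed graph on $V$; a probability distribution $\mathbb P$ on $\mathcal X_V$ *factorizes on* $G$ if there are conditional distributions $p_v(\cdot\mid\cdot)$ of $v$ given its parents $\mathrm{pa}(v)$ with $\mathbb P(X_V=x)=\prod_{v\in V}p_v(x_v\mid x_{\mathrm{pa}(v)})$ for all $x$. In case (a), a set $M$ *separates* $X$ and $Y$ if every path (possibly of length $0$) from a vertex of $X$ to a vertex of $Y$ contains a vertex of $M$. In case (b), a trail is a sequence $v_0,\dots,v_k$ ($k\ge 0$) in which consecutive vertices are joined by an arc in either direction; $v_i$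 is a v-structure of it if $0<i<k$ and $(v_{i-1},v_i)$, $(v_{i+1},v_i)$ are arcs; the trail is active given $M$ if no $v_i$ that is not a v-structure lies in $M$ and every v-structure $v_i$ lies in $M$ or has a descendant in $M$; and $M$ *d-separates* $X$ and $Y$ if no trail from a vertex of $X$ to a vertex of $Y$ is active given $M$. Let $B,C,E\subseteq V$ be arbitrary sets of vertices. A *Markov blanket of $B$ in $C$ given $E$* is a set $M\subseteq C\setminus B$ such that for every $N\subseteq C\setminus B$, $$\Big(X_B\perp\!\!\!\perp X_{C\setminus(B\cup N)}\ \big|\ X_{N\cup E}\ \text{ for every distribution on }\mathcal X_V\text{ that factorizes on }G\Big)\iff M\subseteq N .$$ **Theorem.** In both cases the Markov blanket $\mathrm{mb}_C(B\mid E)$ of $B$ in $C$ given $E$ exists and is unique, and $$\mathrm{mb}_C(B\mid E)=\big\{v\in C\setminus B:\ v\text{ is not separated from }B\text{ given }E\cup(C\setminus(B\cup\{v\}))\big\},$$ where "separated" means separated in case (a) and d-separated in case (b). -/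

import Mathlib

open MeasureTheory ProbabilityTheory

/-! ### Separation and d-separation -/

/-- `M` separates `X` and `Y` in the undirected graph `G`: every path (a sequence of vertices,
possibly of length `0` and possibly with repetitions) from a vertex of `X` to a vertex of `Y`
meets `M`. -/
def Separates {V : Type*} (G : SimpleGraph V) (X Y M : Set V) : Prop :=
  ∀ u ∈ X, ∀ v ∈ Y, ∀ p : G.Walk u v, ∃ w ∈ p.support, w ∈ M

/-- A directed graph is acyclic if it has no directed cycle of positive length. -/
def IsAcyclicDigraph {V : Type*} (G : Digraph V) : Prop :=
  ∀ v : V, ¬ Relation.TransGen G.Adj v v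

/-- `p 0, …, p k` is a trail: consecutive vertices are joined by an arc, in either direction. -/
def IsTrail {V : Type*} (G : Digraph V) (k : ℕ) (p : ℕ → V) : Prop :=
  ∀ i < k, G.Adj (p i) (p (i + 1)) ∨ G.Adj (p (i + 1)) (p i)

/-- The vertex `p i` is a v-structure of the trail `p 0, …, p k`. -/
def IsVStructure {V : Type*} (G : Digraph V) (k : ℕ) (p : ℕ → V) (i : ℕ) : Prop :=
  0 < i ∧ i < k ∧ G.Adj (p (i - 1)) (p i) ∧ G.Adj (p (i + 1)) (p i)

/-- The trail `p 0, …, p k` is active given `M`: the vertices that are not v-structures are not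
in `M`, and each v-structure is in `M` or has a descendant in `M`. -/
def IsActiveTrail {V : Type*} (G : Digraph V) (M : Set V) (k : ℕ) (p : ℕ → V) : Prop :=
  IsTrail G k p ∧ ∀ i ≤ k,
    (¬ IsVStructure G k p i → p i ∉ M) ∧
    (IsVStructure G k p i → ∃ w ∈ M, Relation.ReflTransGen G.Adj (p i) w)

/-- `M` d-separates `X` and `Y` in the directed graph `G`. -/
def DSeparates {V : Type*} (G : Digraph V) (X Y M : Set V) : Prop :=
  ∀ (k : ℕ) (p : ℕ → V), p 0 ∈ X → p k ∈ Y → ¬ IsActiveTrail G M k p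

/-! ### Factorization and conditional independence -/

/-- The distribution `μ` on `∏ v, 𝒳 v` factorizes as an undirected graphical model on `G`: its
mass function is, up to normalization, a product of nonnegative functions of `x_S`, for `S` in
a collection of cliques of `G`. -/
def FactorizesUndirected {V : Type*} {𝒳 : V → Type*}
    [∀ v, MeasurableSpace (𝒳 v)] (G : SimpleGraph V) (μ : Measure (∀ v, 𝒳 v)) : Prop :=
  ∃ (𝒞 : Finset (Finset V)) (ψ : ∀ S : Finset V, (∀ v : S, 𝒳 v) → ℝ) (Z : ℝ),
    (∀ S ∈ 𝒞, G.IsClique (S : Set V)) ∧ (∀ S y, 0 ≤ ψ S y) ∧ 0 < Z ∧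
    ∀ x : ∀ v, 𝒳 v, μ.real {x} = 1 / Z * ∏ S ∈ 𝒞, ψ S (S.restrict x)

/-- The set of parents of `v`. -/
def parentSet {V : Type*} (G : Digraph V) (v : V) : Set V := {u | G.Adj u v}

/-- The distribution `μ` on `∏ v, 𝒳 v` factorizes as a directed graphical model on `G`: its mass
function is a product of conditional distributions of the `x_v` given `x_{parents of v}`. -/
def FactorizesDirected {V : Type*} [Fintype V] {𝒳 : V → Type*} [∀ v, Fintype (𝒳 v)]
    [∀ v, MeasurableSpace (𝒳 v)] (G : Digraph V) (μ : Measure (∀ v, 𝒳 v)) : Prop :=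
  ∃ p : ∀ v : V, 𝒳 v → (∀ u : parentSet G v, 𝒳 u) → ℝ,
    (∀ v a y, 0 ≤ p v a y) ∧ (∀ v y, ∑ a, p v a y = 1) ∧
    ∀ x : ∀ v, 𝒳 v, μ.real {x} = ∏ v, p v (x v) ((parentSet G v).domRestrict x)

/-- Under `μ`, the subvectors `X_A` and `X_D` of the coordinate vector `X` are conditionally
independent given the subvector `X_Z`. -/
def CondIndepSubvectors {V : Type*} [Fintype V] {𝒳 : V → Type*} [∀ v, Fintype (𝒳 v)]
    [∀ v, MeasurableSpace (𝒳 v)] [∀ v, DiscreteMeasurableSpace (𝒳 v)]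
    (μ : Measure (∀ v, 𝒳 v)) [IsProbabilityMeasure μ] (A D Z : Set V) : Prop :=
  CondIndepFun (MeasurableSpace.comap (Z.domRestrict (π := 𝒳)) inferInstance)
    (Measurable.comap_le (measurable_pi_lambda _ fun v => measurable_pi_apply v.1))
    (A.domRestrict (π := 𝒳)) (D.domRestrict (π := 𝒳)) μ

/-- `X_A` is independent from `X_D` given `X_Z` for every distribution on `∏ v, 𝒳 v` that
factorizes as an undirected graphical model on `G`. -/
def IndepUndirected {V : Type*} [Fintype V] (𝒳 : V → Type*) [∀ v, Fintype (𝒳 v)]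
    [∀ v, MeasurableSpace (𝒳 v)] [∀ v, DiscreteMeasurableSpace (𝒳 v)]
    (G : SimpleGraph V) (A D Z : Set V) : Prop :=
  ∀ (μ : Measure (∀ v, 𝒳 v)) [IsProbabilityMeasure μ],
    FactorizesUndirected G μ → CondIndepSubvectors μ A D Z

/-- `X_A` is independent from `X_D` given `X_Z` for every distribution on `∏ v, 𝒳 v` that
factorizes as a directed graphical model on `G`. -/
def IndepDirected {V : Type*} [Fintype V] (𝒳 : V → Type*) [∀ v, Fintype (𝒳 v)]
    [∀ v, MeasurableSpace (𝒳 v)] [∀ v, DiscreteMeasurableSpace (𝒳 v)]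
    (G : Digraph V) (A D Z : Set V) : Prop :=
  ∀ (μ : Measure (∀ v, 𝒳 v)) [IsProbabilityMeasure μ],
    FactorizesDirected G μ → CondIndepSubvectors μ A D Z

/-! ### Markov blanket in a set -/

/-- `M` is the Markov blanket of `B` in `C` given `E`, where `Indep A D Z` expresses that `X_A`
is independent from `X_D` given `X_Z` for every distribution of the graphical model: `M` is the
smallest subset of `C \ B` such that `X_B` is independent from `X_{C \ (B ∪ M)}` given
`X_{M ∪ E}`, in the strong sense that a subset `N` of `C \ B` has this property if and only if
it contains `M`. -/
def IsMarkovBlanketIn {V : Type*} (Indep : Set V → Set V → Set V → Prop)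
    (B C E M : Set V) : Prop :=
  M ⊆ C \ B ∧ ∀ N ⊆ C \ B, Indep B (C \ (B ∪ N)) (N ∪ E) ↔ M ⊆ N


/-!
In both graphical models, `X_B` is independent from `X_D` given `X_Z` for every distribution of the
model if and only if `Z` separates `B` from `D`, and separation is determined by single vertices:
`Z` separates `B` from `D` if and only if `Z ∪ (D \ {v})` separates `B` from `{v}` for each
`v ∈ D`. For `Z = N ∪ E` and `D = C \ (B ∪ N)` the set `Z ∪ (D \ {v})` is
`E ∪ (C \ (B ∪ {v}))` whatever `N` is, so that the condition on `N` says precisely that `N`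
contains every `v ∈ C \ B` that is not separated from `B` given `E ∪ (C \ (B ∪ {v}))`.

The directed case of the reduction to single vertices follows from the undirected one, because
d-separation of `B` and `D` given `Z` is separation in the moral graph of the ancestors of
`B ∪ D ∪ Z`, and this set of vertices does not change when `D` and `Z` are replaced by `{v}` and
`Z ∪ (D \ {v})`.

If `Z` does not separate `B` from `D` in an undirected graph, then a distribution under which
adjacent vertices outside `Z` carry equal bits violates the independence. In a directed graph, a
shortest chain of vertices that leads from `B` to `D` and in which any two consecutive vertices
have a common descendant in `Z` serves the same purpose: these vertices carry arbitrary bits, and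
the default value at the common descendants certifies that consecutive bits agree.
-/

/-! ### Conditional independence of subvectors -/

section CondIndep

variable {V : Type*} {𝒳 : V → Type*}

/-- The event `X_Z = z_Z`: the configurations that agree with `z` on the coordinates in `Z`. -/
def fibre (Z : Set V) (z : ∀ v, 𝒳 v) : Set (∀ v, 𝒳 v) := {x | ∀ v ∈ Z, x v = z v}

lemma mem_fibre_self (Z : Set V) (z : ∀ v, 𝒳 v) : z ∈ fibre Z z := fun _ _ => rfl

lemma fibre_eq_of_mem {Z : Set V} {y z : ∀ v, 𝒳 v} (h : y ∈ fibre Z z) :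
    fibre Z y = fibre Z z :=
  Set.ext fun _ => forall₂_congr fun v hv => by rw [h v hv]

lemma domRestrict_preimage_singleton (Z : Set V) (z : ∀ v, 𝒳 v) :
    Z.domRestrict ⁻¹' {Z.domRestrict z} = fibre Z z := by
  ext x
  simp [fibre, funext_iff]

lemma dependsOn_mem_fibre (Z : Set V) (z : ∀ v, 𝒳 v) : DependsOn (· ∈ fibre Z z) Z :=
  fun _ _ h => propext (forall₂_congr fun v hv => by rw [h v hv])

lemma dependsOn_mem_preimage_domRestrict (A : Set V) (s : Set (∀ v : A, 𝒳 v)) :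
    DependsOn (· ∈ A.domRestrict ⁻¹' s) A :=
  fun _ _ h => congrArg (· ∈ s) (A.dependsOn_domRestrict h)

lemma dependsOn_indicator_one {s : Set (∀ v, 𝒳 v)} {A : Set V} (hs : DependsOn (· ∈ s) A) :
    DependsOn (s.indicator (1 : (∀ v, 𝒳 v) → ℝ)) A := by
  classical
  intro x y h
  have hxy : x ∈ s ↔ y ∈ s := (hs h).to_iff
  simp only [Set.indicator_apply, hxy, Pi.one_apply]

lemma dependsOn_mul {f g : (∀ v, 𝒳 v) → ℝ} {A : Set V} (hf : DependsOn f A)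
    (hg : DependsOn g A) : DependsOn (f * g) A :=
  fun _ _ h => congrArg₂ (· * ·) (hf h) (hg h)

lemma condExp_mul_measureReal_fibre [Finite V] [∀ v, Finite (𝒳 v)] [∀ v, MeasurableSpace (𝒳 v)]
    [∀ v, DiscreteMeasurableSpace (𝒳 v)] (μ : Measure (∀ v, 𝒳 v)) [IsFiniteMeasure μ] (Z : Set V)
    (s : Set (∀ v, 𝒳 v)) (x : ∀ v, 𝒳 v) :
    (μ⟦s | MeasurableSpace.comap (Z.domRestrict (π := 𝒳)) inferInstance⟧) x *
      μ.real (fibre Z x) = μ.real (s ∩ fibre Z x) := by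
  have hs : MeasurableSet s := s.toFinite.measurableSet
  have hone : Integrable (s.indicator fun _ => (1 : ℝ)) μ := (integrable_const 1).indicator hs
  have hm : MeasurableSpace.comap (Z.domRestrict (π := 𝒳)) inferInstance ≤ MeasurableSpace.pi :=
    (measurable_pi_lambda _ fun v => measurable_pi_apply v.1).comap_le
  set m := MeasurableSpace.comap (Z.domRestrict (π := 𝒳)) inferInstance
  have hfibre : MeasurableSet[m] (fibre Z x) :=
    ⟨{Z.domRestrict x}, measurableSet_singleton _, domRestrict_preimage_singleton Z x⟩
  have hconst : ∀ y ∈ fibre Z x, (μ⟦s | m⟧) y = (μ⟦s | m⟧) x := by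
    intro y hy
    obtain ⟨t, -, ht⟩ :=
      (stronglyMeasurable_condExp (μ := μ) (m := m)).measurable
        (measurableSet_singleton ((μ⟦s | m⟧) x))
    have hyx : Z.domRestrict y = Z.domRestrict x := funext fun v => hy v v.2
    have hx : x ∈ (μ⟦s | m⟧) ⁻¹' {(μ⟦s | m⟧) x} := rfl
    change y ∈ (μ⟦s | m⟧) ⁻¹' {(μ⟦s | m⟧) x}
    rw [← ht, Set.mem_preimage] at hx ⊢
    rwa [hyx]
  have h := setIntegral_condExp hm hone hfibre
  rw [setIntegral_congr_fun (hm _ hfibre) hconst, setIntegral_const, setIntegral_indicator hs,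
    setIntegral_const, smul_eq_mul, smul_eq_mul, mul_one] at h
  rw [mul_comm, h, Set.inter_comm]

variable [Fintype V] [∀ v, Fintype (𝒳 v)]

open scoped Classical in
-- Two configurations of the fibre may exchange their coordinates in `A` without leaving it.
lemma sum_fibre_mul_sum_fibre_comm {A Z : Set V} {f₁ f₂ g₁ g₂ : (∀ v, 𝒳 v) → ℝ}
    (hf₁ : DependsOn f₁ (A ∪ Z)) (hf₂ : DependsOn f₂ (A ∪ Z))
    (hg₁ : DependsOn g₁ (Aᶜ ∪ Z)) (hg₂ : DependsOn g₂ (Aᶜ ∪ Z)) (z : ∀ v, 𝒳 v) :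
    (∑ x with x ∈ fibre Z z, f₁ x * g₁ x) * ∑ x with x ∈ fibre Z z, f₂ x * g₂ x =
      (∑ x with x ∈ fibre Z z, f₁ x * g₂ x) * ∑ x with x ∈ fibre Z z, f₂ x * g₁ x := by
  simp only [Finset.sum_mul_sum, ← Finset.sum_product']
  have swap_mem : ∀ x ∈ fibre Z z, ∀ y ∈ fibre Z z, A.piecewise x y ∈ fibre Z z := by
    intro x hx y hy v hv
    by_cases h : v ∈ A <;> simp [h, hx v hv, hy v hv]
  have swap_left : ∀ x ∈ fibre Z z, ∀ y ∈ fibre Z z, ∀ v ∈ A ∪ Z, A.piecewise x y v = x v := by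
    intro x hx y hy v hv
    by_cases h : v ∈ A
    · simp [h]
    · simp [h, hx v (hv.resolve_left h), hy v (hv.resolve_left h)]
  have swap_right : ∀ x ∈ fibre Z z, ∀ y ∈ fibre Z z, ∀ v ∈ Aᶜ ∪ Z,
      A.piecewise x y v = y v := by
    intro x hx y hy v hv
    by_cases h : v ∈ A
    · simp [h, hx v (hv.resolve_left (· h)), hy v (hv.resolve_left (· h))]
    · simp [h]
  have swap_swap : ∀ x y : ∀ v, 𝒳 v, A.piecewise (A.piecewise x y) (A.piecewise y x) = x := by
    intro x y
    ext v
    by_cases h : v ∈ A <;> simp [h]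
  refine Finset.sum_nbij' (fun q => (A.piecewise q.1 q.2, A.piecewise q.2 q.1))
    (fun q => (A.piecewise q.1 q.2, A.piecewise q.2 q.1)) ?_ ?_ ?_ ?_ ?_
  all_goals
    rintro ⟨x, y⟩ hxy
    simp only [Finset.mem_product, Finset.mem_filter_univ] at hxy
  · simpa using ⟨swap_mem x hxy.1 y hxy.2, swap_mem y hxy.2 x hxy.1⟩
  · simpa using ⟨swap_mem x hxy.1 y hxy.2, swap_mem y hxy.2 x hxy.1⟩
  · exact Prod.ext (swap_swap x y) (swap_swap y x)
  · exact Prod.ext (swap_swap x y) (swap_swap y x)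
  · simp only [hf₁ (swap_left x hxy.1 y hxy.2), hf₂ (swap_left y hxy.2 x hxy.1),
      hg₂ (swap_right x hxy.1 y hxy.2), hg₁ (swap_right y hxy.2 x hxy.1)]
    ring

variable [∀ v, MeasurableSpace (𝒳 v)] [∀ v, DiscreteMeasurableSpace (𝒳 v)]
  (μ : Measure (∀ v, 𝒳 v)) [IsProbabilityMeasure μ]

lemma condIndepSubvectors_iff (A D Z : Set V) :
    CondIndepSubvectors μ A D Z ↔
      ∀ (s : Set (∀ v : A, 𝒳 v)) (t : Set (∀ v : D, 𝒳 v)) (x : ∀ v, 𝒳 v),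
        μ.real (A.domRestrict ⁻¹' s ∩ D.domRestrict ⁻¹' t ∩ fibre Z x) * μ.real (fibre Z x) =
          μ.real (A.domRestrict ⁻¹' s ∩ fibre Z x) *
            μ.real (D.domRestrict ⁻¹' t ∩ fibre Z x) := by
  have hmeas (S : Set V) : Measurable (S.domRestrict (π := 𝒳)) :=
    measurable_pi_lambda _ fun v => measurable_pi_apply v.1
  have product_iff : ∀ {p q r a : ℝ}, a ≠ 0 → (p = q * r ↔ p * a * a = q * a * (r * a)) :=
    fun {p q r a} ha => by
      rw [show q * a * (r * a) = q * r * a * a by ring, mul_left_inj' ha, mul_left_inj' ha]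
  rw [CondIndepSubvectors, condIndepFun_iff_condExp_inter_preimage_eq_mul (hmeas A) (hmeas D)]
  constructor
  · intro h s t x
    by_cases hnull : μ (fibre Z x) = 0
    · have hzero : ∀ r : Set (∀ v, 𝒳 v), μ.real (r ∩ fibre Z x) = 0 := fun r => by
        rw [Measure.real, measure_mono_null Set.inter_subset_right hnull, ENNReal.toReal_zero]
      rw [hzero, hzero, zero_mul, zero_mul]
    · obtain ⟨y, hy, hy₀⟩ : ∃ y ∈ fibre Z x, μ {y} ≠ 0 := by
        by_contra! hall
        exact hnull ((measure_null_iff_singleton (Set.to_countable _)).2 hall)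
      have hcond := ae_iff_of_countable.1
        (h s t s.toFinite.measurableSet t.toFinite.measurableSet) y hy₀
      rw [← fibre_eq_of_mem hy] at hnull ⊢
      simp only [← condExp_mul_measureReal_fibre]
      exact (product_iff ((measureReal_ne_zero_iff (measure_ne_top μ _)).2 hnull)).1 hcond
  · intro h s t _ _
    refine ae_iff_of_countable.2 fun x hx => ?_
    have hfibre : μ.real (fibre Z x) ≠ 0 :=
      (measureReal_ne_zero_iff (measure_ne_top μ _)).2 fun h₀ =>
        hx (measure_mono_null (Set.singleton_subset_iff.2 (mem_fibre_self Z x)) h₀)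
    rw [product_iff hfibre, condExp_mul_measureReal_fibre, condExp_mul_measureReal_fibre,
      condExp_mul_measureReal_fibre]
    exact h s t x

open scoped Classical in
lemma condIndepSubvectors_of_factor {A B D Z W : Set V} {f g : (∀ v, 𝒳 v) → ℝ}
    (hf : DependsOn f (A ∪ Z)) (hg : DependsOn g (Aᶜ ∪ Z))
    (hB : B ⊆ A ∪ Z) (hD : D ⊆ Aᶜ ∪ Z) (hBW : B ⊆ W) (hDW : D ⊆ W) (hZW : Z ⊆ W)
    (hμ : ∀ F : (∀ v, 𝒳 v) → ℝ, DependsOn F W →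
      ∑ x, F x * μ.real {x} = ∑ x, F x * (f x * g x)) :
    CondIndepSubvectors μ B D Z := by
  rw [condIndepSubvectors_iff]
  intro s t z
  set S := B.domRestrict ⁻¹' s
  set T := D.domRestrict ⁻¹' t
  have hS : DependsOn (· ∈ S) B := dependsOn_mem_preimage_domRestrict B s
  have hT : DependsOn (· ∈ T) D := dependsOn_mem_preimage_domRestrict D t
  have measure_eq : ∀ R : Set (∀ v, 𝒳 v), DependsOn (· ∈ R) W →
      μ.real (R ∩ fibre Z z) = ∑ x with x ∈ fibre Z z, R.indicator 1 x * (f x * g x) := by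
    intro R hR
    have hRZ : DependsOn (· ∈ R ∩ fibre Z z) W := fun _ _ h =>
      congrArg₂ And (hR h) ((dependsOn_mem_fibre Z z).mono hZW h)
    have hsum := hμ _ (dependsOn_indicator_one hRZ)
    simp only [Set.indicator_apply, Pi.one_apply, ite_mul, one_mul, zero_mul,
      ← Finset.sum_filter, Finset.filter_filter] at hsum ⊢
    rw [sum_measureReal_singleton, Finset.coe_filter_univ, Set.ofPred_mem_eq] at hsum
    simp only [hsum, Set.mem_inter_iff, and_comm]
  have hexchange := sum_fibre_mul_sum_fibre_comm
    (dependsOn_mul ((dependsOn_indicator_one hS).mono hB) hf) hf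
    (dependsOn_mul ((dependsOn_indicator_one hT).mono hD) hg) hg z
  have hfibre := measure_eq Set.univ fun _ _ _ => rfl
  rw [Set.univ_inter] at hfibre
  rw [hfibre, measure_eq S (hS.mono hBW), measure_eq T (hT.mono hDW),
    measure_eq (S ∩ T) fun _ _ h => congrArg₂ And (hS.mono hBW h) (hT.mono hDW h)]
  simp only [Set.inter_indicator_one, Set.indicator_univ, Pi.mul_apply, Pi.one_apply, one_mul]
    at hexchange ⊢
  convert hexchange using 3 <;> ring

lemma not_condIndepSubvectors_of_eq_iff_eq {B D Z : Set V} {b d : V} (hb : b ∈ B) (hd : d ∈ D)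
    {a : 𝒳 b} {c : 𝒳 d} {x₀ x₁ : ∀ v, 𝒳 v} (h₀ : μ {x₀} ≠ 0) (h₁ : μ {x₁} ≠ 0)
    (hZ : x₁ ∈ fibre Z x₀) (hb₀ : x₀ b ≠ a) (hb₁ : x₁ b = a)
    (hbd : ∀ x ∈ fibre Z x₀, μ {x} ≠ 0 → (x b = a ↔ x d = c)) :
    ¬ CondIndepSubvectors μ B D Z := by
  intro h
  set F := fibre Z x₀
  have hproduct : μ.real ({x | x b = a} ∩ {x | x d = c} ∩ F) * μ.real F =
      μ.real ({x | x b = a} ∩ F) * μ.real ({x | x d = c} ∩ F) :=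
    (condIndepSubvectors_iff μ B D Z).1 h {y | y ⟨b, hb⟩ = a} {y | y ⟨d, hd⟩ = c} x₀
  have hinter : μ.real ({x | x b = a} ∩ {x | x d = c} ∩ F) = μ.real ({x | x b = a} ∩ F) :=
    measureReal_congr <| ae_iff_of_countable.2 fun x hx => propext
      ⟨fun hxF => ⟨hxF.1.1, hxF.2⟩, fun hxF => ⟨⟨hxF.1, (hbd x hxF.2 hx).1 hxF.1⟩, hxF.2⟩⟩
  have hsame : μ.real ({x | x d = c} ∩ F) = μ.real ({x | x b = a} ∩ F) :=
    measureReal_congr <| ae_iff_of_countable.2 fun x hx => propext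
      (and_congr_left fun hxF => (hbd x hxF hx).symm)
  have hevent : μ.real ({x | x b = a} ∩ F) ≠ 0 :=
    (measureReal_ne_zero_iff (measure_ne_top μ _)).2 fun hnull =>
      h₁ (measure_mono_null (Set.singleton_subset_iff.2 (And.intro hb₁ hZ)) hnull)
  have hcompl : μ.real (F \ {x | x b = a}) ≠ 0 :=
    (measureReal_ne_zero_iff (measure_ne_top μ _)).2 fun hnull =>
      h₀ (measure_mono_null
        (Set.singleton_subset_iff.2 (And.intro (mem_fibre_self Z x₀) hb₀)) hnull)
  have hsplit := measureReal_inter_add_sdiff (μ := μ) (s := F)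
    {x : ∀ v, 𝒳 v | x b = a}.toFinite.measurableSet
  rw [hinter, hsame] at hproduct
  rw [mul_left_cancel₀ hevent hproduct, Set.inter_comm] at hsplit
  exact hcompl (by linarith)

end CondIndep

/-! ### Markov blankets -/

section Blanket

variable {V : Type*}

lemma IsMarkovBlanketIn.existsUnique {Indep : Set V → Set V → Set V → Prop} {B C E M : Set V}
    (h : IsMarkovBlanketIn Indep B C E M) : ∃! M : Set V, IsMarkovBlanketIn Indep B C E M := by
  refine ⟨M, h, fun M' h' => Set.Subset.antisymm ?_ ?_⟩
  · exact (h'.2 M h.1).1 ((h.2 M h.1).2 subset_rfl)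
  · exact (h.2 M' h'.1).1 ((h'.2 M' h'.1).2 subset_rfl)

lemma isMarkovBlanketIn_of_forall_singleton {Indep Sep : Set V → Set V → Set V → Prop}
    (hsep : ∀ B D Z, Indep B D Z ↔ Sep B D Z)
    (hsingleton : ∀ B D Z, Sep B D Z ↔ ∀ v ∈ D, Sep B {v} (Z ∪ (D \ {v}))) (B C E : Set V) :
    IsMarkovBlanketIn Indep B C E {v ∈ C \ B | ¬ Sep B {v} (E ∪ (C \ (B ∪ {v})))} := by
  refine ⟨fun v hv => hv.1, fun N hN => ?_⟩
  have hrest : ∀ v ∈ C \ (B ∪ N),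
      N ∪ E ∪ ((C \ (B ∪ N)) \ {v}) = E ∪ (C \ (B ∪ {v})) := by
    rintro v ⟨-, hv⟩
    have hNv : ∀ w ∈ N, w ≠ v := fun w hw hwv => hv (Or.inr (hwv ▸ hw))
    ext w
    have hw := @hN w
    have hwv := hNv w
    simp only [Set.mem_union, Set.mem_sdiff, Set.mem_singleton_iff] at hw ⊢
    tauto
  rw [hsep, hsingleton]
  constructor
  · rintro h v ⟨hvCB, hv⟩
    by_contra hvN
    have hvD : v ∈ C \ (B ∪ N) := ⟨hvCB.1, fun h => h.elim hvCB.2 hvN⟩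
    exact hv (hrest v hvD ▸ h v hvD)
  · intro h v hv
    rw [hrest v hv]
    by_contra hcon
    exact hv.2 (Or.inr (h ⟨⟨hv.1, fun hvB => hv.2 (Or.inl hvB)⟩, hcon⟩))

end Blanket

lemma exists_isProbabilityMeasure_of_weights {Ω : Type*} [Fintype Ω] [MeasurableSpace Ω]
    [MeasurableSingletonClass Ω] (w : Ω → ℝ) (hw : ∀ x, 0 ≤ w x) (hsum : ∑ x, w x = 1) :
    ∃ μ : Measure Ω, IsProbabilityMeasure μ ∧ ∀ x, μ.real {x} = w x := by
  have hsum' : ∑ x, ENNReal.ofReal (w x) = 1 := by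
    rw [← ENNReal.ofReal_sum_of_nonneg fun x _ => hw x, hsum, ENNReal.ofReal_one]
  refine ⟨(PMF.ofFintype _ hsum').toMeasure, inferInstance, fun x => ?_⟩
  rw [Measure.real, PMF.toMeasure_apply_singleton _ _ (measurableSet_singleton x),
    PMF.ofFintype_apply, ENNReal.toReal_ofReal (hw x)]

/-! ### Undirected graphical models -/

section Undirected

variable {V : Type*}

/-- Adjacency in the graph that remains of `G` when the vertices of `Z` are deleted, as a relation
on all vertices. -/
def FreeAdj (G : SimpleGraph V) (Z : Set V) (u v : V) : Prop := G.Adj u v ∧ u ∉ Z ∧ v ∉ Z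

lemma not_separates_iff {G : SimpleGraph V} {B D Z : Set V} :
    ¬ Separates G B D Z ↔
      ∃ b ∈ B, b ∉ Z ∧ ∃ d ∈ D, Relation.ReflTransGen (FreeAdj G Z) b d := by
  simp only [Separates, not_forall, not_exists, not_and, exists_prop]
  constructor
  · rintro ⟨b, hb, d, hd, p, hp⟩
    refine ⟨b, hb, hp b p.start_mem_support, d, hd, ?_⟩
    clear hb hd
    induction p with
    | nil => exact .refl
    | cons hadj p ih =>
      rw [SimpleGraph.Walk.support_cons, List.forall_mem_cons] at hp
      exact .head ⟨hadj, hp.1, hp.2 _ p.start_mem_support⟩ (ih hp.2)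
  · rintro ⟨b, hb, hbZ, d, hd, h⟩
    obtain ⟨p, hp⟩ : ∃ p : G.Walk b d, ∀ w ∈ p.support, w ∉ Z := by
      clear hd
      induction h with
      | refl => exact ⟨.nil, by simpa using hbZ⟩
      | tail _ hstep ih =>
        obtain ⟨p, hp⟩ := ih
        refine ⟨p.concat hstep.1, fun w hw => ?_⟩
        rw [SimpleGraph.Walk.support_concat, List.mem_append, List.mem_singleton] at hw
        exact hw.elim (hp w) fun hw => hw ▸ hstep.2.2
    exact ⟨b, hb, d, hd, p, hp⟩

lemma separates_iff_forall_singleton (G : SimpleGraph V) (B D Z : Set V) :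
    Separates G B D Z ↔ ∀ v ∈ D, Separates G B {v} (Z ∪ (D \ {v})) := by
  constructor
  · rintro h v hv b hb _ rfl p
    obtain ⟨w, hw, hwZ⟩ := h b hb _ hv p
    exact ⟨w, hw, Or.inl hwZ⟩
  · -- A walk from `B` to `D` avoiding `Z` can be cut at its first vertex in `D`.
    contrapose!
    simp only [not_separates_iff]
    rintro ⟨b, hb, hbZ, d, hd, hbd⟩
    obtain ⟨v, hv, hbv, hreach⟩ : ∃ v ∈ D, b ∉ Z ∪ (D \ {v}) ∧
        Relation.ReflTransGen (FreeAdj G (Z ∪ (D \ {v}))) b v := by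
      clear hb
      induction hbd using Relation.ReflTransGen.head_induction_on with
      | refl => exact ⟨d, hd, by simpa using hbZ, .refl⟩
      | @head a c hstep _ ih =>
        by_cases haD : a ∈ D
        · exact ⟨a, haD, by simpa using hbZ, .refl⟩
        · obtain ⟨v, hv, hcv, hreach⟩ := ih hstep.2.2
          have hav : a ∉ Z ∪ (D \ {v}) := fun h => h.elim hbZ fun h => haD h.1
          exact ⟨v, hv, hav, .head ⟨hstep.1, hav, hcv⟩ hreach⟩
    exact ⟨v, hv, b, hb, hbv, v, rfl, hreach⟩

lemma dependsOn_prod {ι : Type*} {𝒳 : V → Type*} {φ : ι → (∀ v, 𝒳 v) → ℝ} {I : Finset ι}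
    {A : Set V} (h : ∀ i ∈ I, DependsOn (φ i) A) : DependsOn (fun x => ∏ i ∈ I, φ i x) A :=
  fun _ _ hxy => Finset.prod_congr rfl fun i hi => h i hi hxy

variable {𝒳 : V → Type*}

lemma exists_factorizesUndirected_of_adj_compatible [Finite V] [∀ v, Finite (𝒳 v)]
    [∀ v, MeasurableSpace (𝒳 v)] [∀ v, DiscreteMeasurableSpace (𝒳 v)] (G : SimpleGraph V)
    (R : ∀ u v : V, 𝒳 u → 𝒳 v → Prop)
    (hR : ∃ x : ∀ v, 𝒳 v, ∀ u v, G.Adj u v → R u v (x u) (x v)) :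
    ∃ (μ : Measure (∀ v, 𝒳 v)) (_ : IsProbabilityMeasure μ), FactorizesUndirected G μ ∧
      ∀ x, μ {x} ≠ 0 ↔ ∀ u v, G.Adj u v → R u v (x u) (x v) := by
  classical
  have := Fintype.ofFinite V
  have (v : V) := Fintype.ofFinite (𝒳 v)
  let 𝒞 : Finset (Finset V) := {S | G.IsClique (S : Set V)}
  let ψ (S : Finset V) (y : ∀ v : S, 𝒳 v) : ℝ :=
    if ∀ u v : S, G.Adj u v → R u v (y u) (y v) then 1 else 0
  have hψ : ∀ S y, 0 ≤ ψ S y := fun S y => by positivity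
  let weight (x : ∀ v, 𝒳 v) : ℝ := ∏ S ∈ 𝒞, ψ S (S.restrict x)
  have hweight : ∀ x, 0 ≤ weight x := fun x => Finset.prod_nonneg fun S _ => hψ S _
  have weight_ne_zero : ∀ x, weight x ≠ 0 ↔ ∀ u v, G.Adj u v → R u v (x u) (x v) := by
    intro x
    rw [Finset.prod_ne_zero_iff]
    refine ⟨fun h u v huv => ?_, fun h S _ => ?_⟩
    · have hS := h {u, v} (by simp [𝒞, huv])
      simp only [ψ, ne_eq, ite_eq_right_iff, one_ne_zero, imp_false, not_not] at hS
      exact hS ⟨u, by simp⟩ ⟨v, by simp⟩ huv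
    · exact (if_pos fun (u v : S) => h u v).trans_ne one_ne_zero
  obtain ⟨x, hx⟩ := hR
  have htotal : 0 < ∑ x, weight x := Finset.sum_pos' (fun x _ => hweight x)
    ⟨x, Finset.mem_univ x, (hweight x).lt_of_ne' ((weight_ne_zero x).2 hx)⟩
  obtain ⟨μ, hμ, hμw⟩ := exists_isProbabilityMeasure_of_weights
    (fun x => 1 / (∑ x, weight x) * weight x)
    (fun x => mul_nonneg (one_div_pos.2 htotal).le (hweight x))
    (by rw [← Finset.mul_sum, one_div, inv_mul_cancel₀ htotal.ne'])
  refine ⟨μ, hμ, ⟨𝒞, ψ, ∑ x, weight x, fun S hS => (Finset.mem_filter.1 hS).2, hψ, htotal, hμw⟩,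
    fun x => ?_⟩
  rw [← weight_ne_zero, ← measureReal_ne_zero_iff (measure_ne_top μ _), hμw]
  simp [htotal.ne']

variable [Fintype V] [∀ v, Fintype (𝒳 v)]
  [∀ v, MeasurableSpace (𝒳 v)] [∀ v, DiscreteMeasurableSpace (𝒳 v)]

open scoped Classical in
-- A clique that meets the part of `Zᶜ` reachable from `B` lies in the union of that part and `Z`.
lemma condIndepSubvectors_of_separates_of_factors {G : SimpleGraph V} {B D Z W : Set V}
    (hsep : Separates G B D Z) (μ : Measure (∀ v, 𝒳 v)) [IsProbabilityMeasure μ] {ι : Type*}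
    (I : Finset ι) (φ : ι → (∀ v, 𝒳 v) → ℝ) (scope : ι → Set V) (c : ℝ)
    (hφ : ∀ i ∈ I, DependsOn (φ i) (scope i)) (hscope : ∀ i ∈ I, G.IsClique (scope i))
    (hBW : B ⊆ W) (hDW : D ⊆ W) (hZW : Z ⊆ W)
    (hμ : ∀ F : (∀ v, 𝒳 v) → ℝ, DependsOn F W →
      ∑ x, F x * μ.real {x} = ∑ x, F x * (c * ∏ i ∈ I, φ i x)) :
    CondIndepSubvectors μ B D Z := by
  let A : Set V := {v | ∃ b ∈ B, b ∉ Z ∧ Relation.ReflTransGen (FreeAdj G Z) b v}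
  have scope_subset : ∀ i ∈ I, ¬ scope i ⊆ A ∪ Z → scope i ⊆ Aᶜ ∪ Z := by
    intro i hi hnot w hw
    by_contra hwA
    simp only [Set.mem_union, Set.mem_compl_iff, not_or, not_not] at hwA
    obtain ⟨⟨b, hb, hbZ, hbw⟩, hwZ⟩ := hwA
    refine hnot fun u hu => or_iff_not_imp_right.2 fun huZ => ⟨b, hb, hbZ, ?_⟩
    rcases eq_or_ne w u with rfl | hwu
    · exact hbw
    · exact hbw.tail ⟨hscope i hi hw hu hwu, hwZ, huZ⟩
  refine condIndepSubvectors_of_factor μ (A := A)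
    (f := fun x => c * ∏ i ∈ I with scope i ⊆ A ∪ Z, φ i x)
    (g := fun x => ∏ i ∈ I with ¬ scope i ⊆ A ∪ Z, φ i x)
    (fun x y h => congrArg (c * ·) (dependsOn_prod (fun i hi => ?_) h))
    (dependsOn_prod fun i hi => ?_) ?_ ?_ hBW hDW hZW fun F hF => ?_
  · rw [Finset.mem_filter] at hi
    exact (hφ i hi.1).mono hi.2
  · rw [Finset.mem_filter] at hi
    exact (hφ i hi.1).mono (scope_subset i hi.1 hi.2)
  · exact fun b hb => or_iff_not_imp_right.2 fun hbZ => ⟨b, hb, hbZ, .refl⟩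
  · rintro d hd
    exact Or.inl fun ⟨b, hb, hbZ, hbd⟩ => not_separates_iff.2 ⟨b, hb, hbZ, d, hd, hbd⟩ hsep
  · simp only [hμ F hF, mul_assoc, Finset.prod_filter_mul_prod_filter_not]

lemma condIndepSubvectors_of_separates {G : SimpleGraph V} {B D Z : Set V}
    (hsep : Separates G B D Z) (μ : Measure (∀ v, 𝒳 v)) [IsProbabilityMeasure μ]
    (hμ : FactorizesUndirected G μ) : CondIndepSubvectors μ B D Z := by
  classical
  obtain ⟨𝒞, ψ, c, hclique, -, -, hfactor⟩ := hμ
  exact condIndepSubvectors_of_separates_of_factors hsep μ 𝒞 (fun S x => ψ S (S.restrict x))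
    (fun S => S) (1 / c) (fun S _ _ _ h => congrArg (ψ S) (S.dependsOn_restrict h)) hclique
    (Set.subset_univ B) (Set.subset_univ D) (Set.subset_univ Z)
    fun F _ => by simp only [hfactor]

-- Under the witness, the bits `x v = e v` are constant along walks that avoid `Z`.
lemma indepUndirected_iff_separates [∀ v, Nontrivial (𝒳 v)] (G : SimpleGraph V)
    (B D Z : Set V) : IndepUndirected 𝒳 G B D Z ↔ Separates G B D Z := by
  classical
  refine ⟨fun hindep => ?_, fun hsep μ _ => condIndepSubvectors_of_separates hsep μ⟩
  by_contra hsep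
  obtain ⟨b, hb, hbZ, d, hd, hbd⟩ := not_separates_iff.1 hsep
  choose o e hoe using fun v => exists_pair_ne (𝒳 v)
  obtain ⟨μ, hμ, hfactor, hsupport⟩ := exists_factorizesUndirected_of_adj_compatible G
    (fun u v x y => u ∉ Z → v ∉ Z → (x = e u ↔ y = e v)) ⟨o, by simp [hoe]⟩
  have bit_eq : ∀ x, μ {x} ≠ 0 → (x b = e b ↔ x d = e d) := by
    intro x hx
    clear hd
    induction hbd with
    | refl => rfl
    | tail _ hstep ih =>
      exact ih.trans ((hsupport x).1 hx _ _ hstep.1 hstep.2.1 hstep.2.2)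
  refine not_condIndepSubvectors_of_eq_iff_eq μ hb hd (x₀ := o) (x₁ := Z.piecewise o e) (a := e b)
    ((hsupport o).2 ?_) ((hsupport _).2 ?_) ?_ (hoe b) (by simp [hbZ]) (fun x _ => bit_eq x)
    (hindep μ hfactor)
  · simp [hoe]
  · rintro u v - hu hv
    simp [hu, hv]
  · intro v hv
    simp [hv]

end Undirected

/-! ### Directed graphical models -/

section Marginal

variable {V : Type*} {G : Digraph V}

lemma IsAcyclicDigraph.wellFounded_adj [Finite V] (hG : IsAcyclicDigraph G) :
    WellFounded G.Adj :=
  have : Std.Irrefl (Relation.TransGen G.Adj) := ⟨hG⟩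
  Subrelation.wf .single (Finite.wellFounded_of_trans_of_irrefl (Relation.TransGen G.Adj))

lemma IsAcyclicDigraph.wellFounded_flip_adj [Finite V] (hG : IsAcyclicDigraph G) :
    WellFounded (flip G.Adj) :=
  have : Std.Irrefl (Function.swap (Relation.TransGen G.Adj)) := ⟨hG⟩
  have : IsTrans V (Function.swap (Relation.TransGen G.Adj)) := ⟨fun _ _ _ h h' => h'.trans h⟩
  Subrelation.wf (fun h => .single h)
    (Finite.wellFounded_of_trans_of_irrefl (Function.swap (Relation.TransGen G.Adj)))

/-- A set of vertices is ancestral if it contains the parents of each of its elements. -/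
def IsAncestralSet (G : Digraph V) (W : Set V) : Prop := ∀ v ∈ W, parentSet G v ⊆ W

/-- The vertices from which some vertex of `T` can be reached, including those of `T`. -/
def ancestors (G : Digraph V) (T : Set V) : Set V :=
  {v | ∃ w ∈ T, Relation.ReflTransGen G.Adj v w}

lemma subset_ancestors (T : Set V) : T ⊆ ancestors G T := fun v hv => ⟨v, hv, .refl⟩

lemma isAncestralSet_ancestors (T : Set V) : IsAncestralSet G (ancestors G T) :=
  fun _ ⟨w, hw, hvw⟩ _ huv => ⟨w, hw, .head huv hvw⟩

variable {𝒳 : V → Type*} [∀ v, Fintype (𝒳 v)]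

/-- The densities of the conditional distributions `p` with respect to the uniform distributions.
Their product over any ancestral set of vertices is a probability density, so that no uniform
factors are left behind when vertices are summed out. -/
noncomputable def conditionalDensity (p : ∀ v : V, 𝒳 v → (∀ u : parentSet G v, 𝒳 u) → ℝ) (v : V)
    (x : ∀ v, 𝒳 v) : ℝ :=
  Fintype.card (𝒳 v) * p v (x v) ((parentSet G v).domRestrict x)

variable {p : ∀ v : V, 𝒳 v → (∀ u : parentSet G v, 𝒳 u) → ℝ}

lemma dependsOn_conditionalDensity (v : V) :
    DependsOn (conditionalDensity p v) (insert v (parentSet G v)) := by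
  intro x y h
  have hparents := (parentSet G v).dependsOn_domRestrict
    fun u hu => h u (Set.mem_insert_of_mem v hu)
  rw [conditionalDensity, conditionalDensity, h v (Set.mem_insert v _), hparents]

open scoped Classical in
lemma sum_conditionalDensity_update (hG : IsAcyclicDigraph G)
    (hp : ∀ v y, ∑ a, p v a y = 1) (v : V) (x : ∀ v, 𝒳 v) :
    ∑ a, conditionalDensity p v (Function.update x v a) = Fintype.card (𝒳 v) := by
  have hparents : ∀ a, (parentSet G v).domRestrict (Function.update x v a) =
      (parentSet G v).domRestrict x := fun a => (parentSet G v).dependsOn_domRestrict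
    fun u hu => Function.update_of_ne (by rintro rfl; exact hG u (.single hu)) a x
  simp only [conditionalDensity, hparents, Function.update_self, ← Finset.mul_sum, hp, mul_one]

variable [Fintype V]

open scoped Classical in
lemma sum_sum_update (s : V) (F : (∀ v, 𝒳 v) → ℝ) :
    ∑ x, ∑ a, F (Function.update x s a) = Fintype.card (𝒳 s) * ∑ x, F x := by
  have hconst : ∑ x : (∀ v, 𝒳 v), ∑ _a : 𝒳 s, F x = Fintype.card (𝒳 s) * ∑ x, F x := by
    simp only [Finset.sum_const, Finset.card_univ, nsmul_eq_mul, Finset.mul_sum]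
  rw [← hconst, ← Finset.sum_product', ← Finset.sum_product']
  exact Finset.sum_nbij' (fun q => (Function.update q.1 s q.2, q.1 s))
    (fun q => (Function.update q.1 s q.2, q.1 s)) (by simp) (by simp) (by simp) (by simp) (by simp)

open scoped Classical in
lemma sum_mul_eq_sum_of_sum_update {s : V} {H q : (∀ v, 𝒳 v) → ℝ} (hH : DependsOn H {s}ᶜ)
    (hq : ∀ x, ∑ a, q (Function.update x s a) = Fintype.card (𝒳 s)) :
    ∑ x, H x * q x = ∑ x, H x := by
  rcases isEmpty_or_nonempty (𝒳 s) with hempty | hnonempty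
  · have : IsEmpty (∀ v, 𝒳 v) := ⟨fun x => hempty.elim (x s)⟩
    simp only [Finset.univ_eq_empty, Finset.sum_empty]
  · have hcard : (Fintype.card (𝒳 s) : ℝ) ≠ 0 := Nat.cast_ne_zero.2 Fintype.card_ne_zero
    have hupdate : ∀ x a, H (Function.update x s a) = H x :=
      fun x a => hH fun v hv => Function.update_of_ne hv a x
    refine mul_left_cancel₀ hcard ?_
    simp only [← sum_sum_update s (fun x => H x * q x), hupdate, ← Finset.mul_sum, hq,
      ← Finset.sum_mul, mul_comm]

open scoped Classical in
-- The factors outside `W` are summed out one at a time, starting with a sink of the graph.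
lemma sum_mul_prod_eq_of_isAncestralSet (hG : IsAcyclicDigraph G) {q : V → (∀ v, 𝒳 v) → ℝ}
    (hdep : ∀ v, DependsOn (q v) (insert v (parentSet G v)))
    (hq : ∀ v x, ∑ a, q v (Function.update x v a) = Fintype.card (𝒳 v))
    {W : Finset V} (hW : IsAncestralSet G W) {F : (∀ v, 𝒳 v) → ℝ} (hF : DependsOn F W)
    {U : Finset V} (hU : IsAncestralSet G U) (hWU : W ⊆ U) :
    ∑ x, F x * ∏ v ∈ U, q v x = ∑ x, F x * ∏ v ∈ W, q v x := by
  induction U using Finset.strongInduction with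
  | H U ih =>
    rcases hWU.eq_or_ssubset with rfl | hssubset
    · rfl
    obtain ⟨s, hs, hsink⟩ := hG.wellFounded_flip_adj.has_min (↑(U \ W) : Set V)
      (Finset.coe_nonempty.2 (Finset.sdiff_nonempty.2 hssubset.2))
    simp only [Finset.coe_sdiff, Set.mem_sdiff, Finset.mem_coe, flip] at hs hsink
    have hchildless : ∀ v ∈ U, ¬ G.Adj s v := fun v hv hsv =>
      hsink v ⟨hv, fun hvW => hs.2 (hW v hvW hsv)⟩ hsv
    have herase : IsAncestralSet G ↑(U.erase s) := by
      intro v hv u huv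
      rw [Finset.mem_coe, Finset.mem_erase] at hv ⊢
      exact ⟨fun hus => hchildless v hv.2 (hus ▸ huv), hU v hv.2 huv⟩
    have hWerase : W ⊆ U.erase s := Finset.subset_erase.2 ⟨hWU, hs.2⟩
    have hrest : DependsOn (fun x => F x * ∏ v ∈ U.erase s, q v x) ({s}ᶜ : Set V) := by
      refine dependsOn_mul (hF.mono ?_) (dependsOn_prod fun v hv => (hdep v).mono ?_)
      · exact Set.subset_compl_singleton_iff.2 hs.2
      · rw [Set.subset_compl_singleton_iff, Set.mem_insert_iff, not_or]
        rw [Finset.mem_erase] at hv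
        exact ⟨hv.1.symm, hchildless v hv.2⟩
    rw [← ih _ (Finset.erase_ssubset hs.1) herase hWerase,
      ← sum_mul_eq_sum_of_sum_update hrest (hq s)]
    simp only [mul_assoc, Finset.prod_erase_mul _ _ hs.1]

lemma prod_conditional_eq [∀ v, Nonempty (𝒳 v)] (x : ∀ v, 𝒳 v) :
    ∏ v, p v (x v) ((parentSet G v).domRestrict x) =
      (∏ v, (Fintype.card (𝒳 v) : ℝ))⁻¹ * ∏ v, conditionalDensity p v x := by
  have hcard : ∏ v, (Fintype.card (𝒳 v) : ℝ) ≠ 0 :=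
    Finset.prod_ne_zero_iff.2 fun v _ => Nat.cast_ne_zero.2 Fintype.card_ne_zero
  simp only [conditionalDensity, Finset.prod_mul_distrib, inv_mul_cancel_left₀ hcard]

open scoped Classical in
lemma sum_prod_conditional_eq_one [∀ v, Nonempty (𝒳 v)] (hG : IsAcyclicDigraph G)
    (hp : ∀ v y, ∑ a, p v a y = 1) :
    ∑ x : ∀ v, 𝒳 v, ∏ v, p v (x v) ((parentSet G v).domRestrict x) = 1 := by
  have h := sum_mul_prod_eq_of_isAncestralSet hG (dependsOn_conditionalDensity (p := p))
    (sum_conditionalDensity_update hG hp) (W := ∅) (by simp [IsAncestralSet])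
    (F := fun _ => 1) (fun _ _ _ => rfl) (U := Finset.univ) (by simp [IsAncestralSet])
    (Finset.empty_subset _)
  simp only [one_mul, Finset.prod_empty, Finset.sum_const, Finset.card_univ, nsmul_eq_mul,
    mul_one, Fintype.card_pi, Nat.cast_prod] at h
  simp only [prod_conditional_eq, ← Finset.mul_sum, h]
  exact inv_mul_cancel₀ (Finset.prod_ne_zero_iff.2 fun v _ =>
    Nat.cast_ne_zero.2 Fintype.card_ne_zero)

variable [∀ v, MeasurableSpace (𝒳 v)] [∀ v, DiscreteMeasurableSpace (𝒳 v)]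

lemma exists_factorizesDirected_of_allowed [∀ v, Nonempty (𝒳 v)] (hG : IsAcyclicDigraph G)
    (allowed : ∀ v : V, (∀ u : parentSet G v, 𝒳 u) → Set (𝒳 v))
    (hallowed : ∀ v y, (allowed v y).Nonempty) :
    ∃ (μ : Measure (∀ v, 𝒳 v)) (_ : IsProbabilityMeasure μ), FactorizesDirected G μ ∧
      ∀ x, μ {x} ≠ 0 ↔ ∀ v, x v ∈ allowed v ((parentSet G v).domRestrict x) := by
  classical
  let p : ∀ v : V, 𝒳 v → (∀ u : parentSet G v, 𝒳 u) → ℝ := fun v a y =>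
    if a ∈ allowed v y then ((allowed v y).ncard : ℝ)⁻¹ else 0
  have hncard : ∀ v y, ((allowed v y).ncard : ℝ) ≠ 0 := fun v y =>
    Nat.cast_ne_zero.2 (((Set.ncard_pos).2 (hallowed v y)).ne')
  have hp_nonneg : ∀ v a y, 0 ≤ p v a y := fun v a y => by positivity
  have hp_sum : ∀ v y, ∑ a, p v a y = 1 := fun v y => by
    simp only [p, ← Finset.sum_filter, Finset.sum_const, nsmul_eq_mul]
    rw [← Set.ncard_coe_finset, Finset.coe_filter_univ]
    exact mul_inv_cancel₀ (hncard v y)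
  obtain ⟨μ, hμ, hμp⟩ := exists_isProbabilityMeasure_of_weights _
    (fun x => Finset.prod_nonneg fun v _ => hp_nonneg v (x v) ((parentSet G v).domRestrict x))
    (sum_prod_conditional_eq_one hG hp_sum)
  refine ⟨μ, hμ, ⟨p, hp_nonneg, hp_sum, hμp⟩, fun x => ?_⟩
  simp [← measureReal_ne_zero_iff (measure_ne_top μ _), hμp, Finset.prod_ne_zero_iff, p, hncard]

end Marginal

/-! ### Moral graphs and d-separation -/

section Moral

variable {V : Type*} {G : Digraph V} {B D T Z : Set V}

/-- The moral graph of the subgraph of `G` induced on the ancestors of `T`: two vertices are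
adjacent if they occur together in a family, consisting of a vertex and its parents, within that
subgraph. -/
def moralGraph (G : Digraph V) (T : Set V) : SimpleGraph V where
  Adj u v := u ≠ v ∧
    ∃ c ∈ ancestors G T, u ∈ insert c (parentSet G c) ∧ v ∈ insert c (parentSet G c)
  symm := ⟨fun _ _ ⟨hne, c, hc, hu, hv⟩ => ⟨hne.symm, c, hc, hv, hu⟩⟩
  loopless := ⟨fun _ h => h.1 rfl⟩

lemma isClique_moralGraph_family {c : V} (hc : c ∈ ancestors G T) :
    (moralGraph G T).IsClique (insert c (parentSet G c)) :=
  fun _ hu _ hv hne => ⟨hne, c, hc, hu, hv⟩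

lemma reflTransGen_freeAdj_moralGraph {c u v : V} (hc : c ∈ ancestors G T)
    (hu : u ∈ insert c (parentSet G c)) (hv : v ∈ insert c (parentSet G c)) (huZ : u ∉ Z)
    (hvZ : v ∉ Z) : Relation.ReflTransGen (FreeAdj (moralGraph G T) Z) u v := by
  rcases eq_or_ne u v with rfl | hne
  · exact .refl
  · exact .single ⟨⟨hne, c, hc, hu, hv⟩, huZ, hvZ⟩

lemma IsAcyclicDigraph.not_adj_of_adj (hG : IsAcyclicDigraph G) {u v : V} (h : G.Adj u v) :
    ¬ G.Adj v u :=
  fun h' => hG u (.tail (.single h) h')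

-- A vertex of the trail that is neither an end nor a v-structure has a child on the trail.
lemma IsActiveTrail.mem_ancestors [Finite V] (hG : IsAcyclicDigraph G) {k : ℕ} {p : ℕ → V}
    (hp : IsActiveTrail G Z k p) (hstart : p 0 ∈ T) (hend : p k ∈ T) (hZT : Z ⊆ T) :
    ∀ i ≤ k, p i ∈ ancestors G T := by
  suffices ∀ v, ∀ i ≤ k, p i = v → v ∈ ancestors G T from fun i hi => this _ i hi rfl
  intro v
  induction v using hG.wellFounded_flip_adj.induction with
  | _ v ih =>
    rintro i hi rfl
    by_cases hvstruct : IsVStructure G k p i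
    · obtain ⟨w, hw, hiw⟩ := (hp.2 i hi).2 hvstruct
      exact ⟨w, hZT hw, hiw⟩
    · rcases Nat.eq_zero_or_pos i with rfl | hpos
      · exact subset_ancestors T hstart
      rcases hi.eq_or_lt with rfl | hlt
      · exact subset_ancestors T hend
      obtain ⟨j, hj, hchild⟩ : ∃ j ≤ k, G.Adj (p i) (p j) := by
        by_contra! hnone
        have hprev := hp.1 (i - 1) (by omega)
        rw [Nat.sub_add_cancel hpos] at hprev
        exact hvstruct ⟨hpos, hlt, hprev.resolve_right (hnone (i - 1) (by omega)),
          (hp.1 i hlt).resolve_left (hnone (i + 1) hlt)⟩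
      exact isAncestralSet_ancestors T _ (ih (p j) hchild j hj rfl) hchild

-- The walk in the moral graph skips the v-structures: the two neighbours of a v-structure are
-- parents of it.
lemma IsActiveTrail.reflTransGen_freeAdj [Finite V] (hG : IsAcyclicDigraph G) {k : ℕ}
    {p : ℕ → V} (hp : IsActiveTrail G Z k p) (hstart : p 0 ∈ T) (hend : p k ∈ T) (hZT : Z ⊆ T) :
    ∀ i ≤ k, ¬ IsVStructure G k p i →
      Relation.ReflTransGen (FreeAdj (moralGraph G T) Z) (p 0) (p i) := by
  have hancestors := hp.mem_ancestors hG hstart hend hZT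
  intro i
  induction i using Nat.strong_induction_on with
  | _ i ih =>
    intro hi hvi
    rcases i with _ | i
    · exact .refl
    have hiZ : p (i + 1) ∉ Z := (hp.2 (i + 1) hi).1 hvi
    by_cases hprev : IsVStructure G k p i
    · obtain ⟨j, rfl⟩ := Nat.exists_eq_succ_of_ne_zero hprev.1.ne'
      have hparents : G.Adj (p j) (p (j + 1)) ∧ G.Adj (p (j + 2)) (p (j + 1)) := hprev.2.2
      have hvj : ¬ IsVStructure G k p j := fun h => hG.not_adj_of_adj hparents.1 h.2.2.2
      exact (ih j (by omega) (by omega) hvj).trans <|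
        reflTransGen_freeAdj_moralGraph (hancestors (j + 1) (by omega)) (Or.inr hparents.1)
          (Or.inr hparents.2) ((hp.2 j (by omega)).1 hvj) hiZ
    · have hprevZ := (hp.2 i (by omega)).1 hprev
      refine (ih i (by omega) (by omega) hprev).trans ?_
      rcases hp.1 i (by omega) with harc | harc
      · exact reflTransGen_freeAdj_moralGraph (hancestors (i + 1) hi) (Or.inr harc) (Or.inl rfl)
          hprevZ hiZ
      · exact reflTransGen_freeAdj_moralGraph (hancestors i (by omega)) (Or.inl rfl)
          (Or.inr harc) hprevZ hiZ

lemma dSeparates_of_separates_moralGraph [Finite V] (hG : IsAcyclicDigraph G)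
    (hsep : Separates (moralGraph G (B ∪ D ∪ Z)) B D Z) : DSeparates G B D Z := by
  intro k p hB hD hp
  have hstart : ¬ IsVStructure G k p 0 := fun h => h.1.false
  have hend : ¬ IsVStructure G k p k := fun h => h.2.1.false
  exact not_separates_iff.2 ⟨p 0, hB, (hp.2 0 k.zero_le).1 hstart, p k, hD,
    hp.reflTransGen_freeAdj hG (Or.inl (Or.inl hB)) (Or.inl (Or.inr hD)) Set.subset_union_right
      k le_rfl hend⟩ hsep

/-- An arc that leaves a vertex outside `Z`. -/
def FreeArc (G : Digraph V) (Z : Set V) (u v : V) : Prop := u ∉ Z ∧ G.Adj u v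

/-- There is a directed path from `u` to `v` all of whose vertices, except possibly `v`, lie
outside `Z`. -/
def FreeDescent (G : Digraph V) (Z : Set V) : V → V → Prop := Relation.ReflTransGen (FreeArc G Z)

/-- Two vertices outside `Z` are coupled if conditioning on `Z` can make them dependent as common
causes of an observed effect. -/
def Coupled (G : Digraph V) (Z : Set V) (u v : V) : Prop :=
  u ∉ Z ∧ v ∉ Z ∧ ∃ z ∈ Z, FreeDescent G Z u z ∧ FreeDescent G Z v z

/-- The vertices that are joined to a vertex of `S` outside `Z` by a directed path avoiding `Z`. -/
def freeAncestors (G : Digraph V) (Z S : Set V) : Set V := {v | ∃ w ∈ S \ Z, FreeDescent G Z v w}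

lemma FreeDescent.notMem {u v : V} (h : FreeDescent G Z u v) (hv : v ∉ Z) : u ∉ Z := by
  obtain rfl | ⟨_, hstep, -⟩ := Relation.ReflTransGen.cases_head h
  · exact hv
  · exact hstep.1

lemma FreeDescent.transGen {u v : V} (h : FreeDescent G Z u v) (hu : u ∉ Z) (hv : v ∈ Z) :
    Relation.TransGen (FreeArc G Z) u v :=
  (Relation.reflTransGen_iff_eq_or_transGen.1 h).resolve_left fun huv => hu (huv ▸ hv)

lemma subset_freeAncestors : B \ Z ⊆ freeAncestors G Z B := fun b hb => ⟨b, hb, .refl⟩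

lemma exists_freeDescent_of_mem_ancestors {c : V} (hc : c ∈ ancestors G T) :
    ∃ t ∈ T ∪ Z, FreeDescent G Z c t := by
  obtain ⟨w, hw, hcw⟩ := hc
  induction hcw using Relation.ReflTransGen.head_induction_on with
  | refl => exact ⟨w, Or.inl hw, .refl⟩
  | @head a c harc _ ih =>
    by_cases haZ : a ∈ Z
    · exact ⟨a, Or.inr haZ, .refl⟩
    · obtain ⟨t, ht, hct⟩ := ih
      exact ⟨t, ht, .head ⟨haZ, harc⟩ hct⟩

lemma freeDescent_of_mem_family {c t v : V} (hv : v ∈ insert c (parentSet G c)) (hvZ : v ∉ Z)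
    (hct : FreeDescent G Z c t) : FreeDescent G Z v t := by
  rcases hv with rfl | hv
  · exact hct
  · exact .head ⟨hvZ, hv⟩ hct

-- Along a walk in the moral graph from `B`, either the last vertex can be reached by a chain of
-- couplings from a free ancestor of `B`, or such a chain to a free ancestor of `D` has been found.
lemma exists_coupled_chain_of_not_separates_moralGraph
    (hsep : ¬ Separates (moralGraph G (B ∪ D ∪ Z)) B D Z) :
    ∃ u ∈ freeAncestors G Z B, ∃ v ∈ freeAncestors G Z D,
      Relation.ReflTransGen (Coupled G Z) u v := by
  obtain ⟨b, hb, hbZ, d, hd, hbd⟩ := not_separates_iff.1 hsep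
  by_contra! hnone
  have hdZ : d ∉ Z := by
    obtain rfl | ⟨_, -, hstep⟩ := Relation.ReflTransGen.cases_tail hbd
    · exact hbZ
    · exact hstep.2.2
  obtain ⟨u, hu, hud⟩ : ∃ u ∈ freeAncestors G Z B, Relation.ReflTransGen (Coupled G Z) u d := by
    clear hd hdZ
    induction hbd with
    | refl => exact ⟨b, subset_freeAncestors ⟨hb, hbZ⟩, .refl⟩
    | @tail v w _ hstep ih =>
      obtain ⟨u, hu, huv⟩ := ih
      obtain ⟨⟨-, c, hc, hvc, hwc⟩, hvZ, hwZ⟩ := hstep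
      obtain ⟨t, ht, hct⟩ := exists_freeDescent_of_mem_ancestors (Z := Z) hc
      have hvt := freeDescent_of_mem_family hvc hvZ hct
      have hwt := freeDescent_of_mem_family hwc hwZ hct
      by_cases htZ : t ∈ Z
      · exact ⟨u, hu, huv.tail ⟨hvZ, hwZ, t, htZ, hvt, hwt⟩⟩
      · rcases (ht.resolve_right htZ).resolve_right htZ with htB | htD
        · exact ⟨w, ⟨t, ⟨htB, htZ⟩, hwt⟩, .refl⟩
        · exact absurd huv (hnone u hu v ⟨t, ⟨htD, htZ⟩, hvt⟩)
  exact hnone u hu d (subset_freeAncestors ⟨hd, hdZ⟩) hud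

/-- There is a trail from `B` to `v` that satisfies the conditions of an active trail at all its
vertices except the last one; its last arc points into `v` if and only if `into` holds. -/
def ActiveUpTo (G : Digraph V) (Z B : Set V) (v : V) (into : Prop) : Prop :=
  ∃ (k : ℕ) (p : ℕ → V), p 0 ∈ B ∧ p k = v ∧ IsTrail G k p ∧
    (∀ i < k, (¬ IsVStructure G k p i → p i ∉ Z) ∧
      (IsVStructure G k p i → ∃ w ∈ Z, Relation.ReflTransGen G.Adj (p i) w)) ∧
    ((0 < k ∧ G.Adj (p (k - 1)) (p k)) ↔ into)

lemma ActiveUpTo.refl {b : V} (hb : b ∈ B) : ActiveUpTo G Z B b False :=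
  ⟨0, fun _ => b, hb, rfl, by simp [IsTrail], by simp, by simp⟩

lemma ActiveUpTo.not_dSeparates {d : V} {into : Prop} (h : ActiveUpTo G Z B d into) (hd : d ∈ D)
    (hdZ : d ∉ Z) : ¬ DSeparates G B D Z := by
  obtain ⟨k, p, hB, rfl, htrail, hactive, -⟩ := h
  refine fun hsep => hsep k p hB hd ⟨htrail, fun i hi => ?_⟩
  rcases hi.lt_or_eq with hlt | rfl
  · exact hactive i hlt
  · exact ⟨fun _ => hdZ, fun h => absurd h.2.1 i.lt_irrefl⟩

lemma ActiveUpTo.step {v w : V} {into : Prop} (h : ActiveUpTo G Z B v into)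
    (hadj : G.Adj v w ∨ G.Adj w v) (hv : into ∧ G.Adj w v ↔ v ∈ Z) :
    ActiveUpTo G Z B w (G.Adj v w) := by
  classical
  obtain ⟨k, p, hB, rfl, htrail, hactive, hinto⟩ := h
  set q := Function.update p (k + 1) w with hq
  have hqp : ∀ i ≤ k, q i = p i := fun i hi => Function.update_of_ne (by omega) w p
  have hqw : q (k + 1) = w := Function.update_self (k + 1) w p
  refine ⟨k + 1, q, by rwa [hqp 0 k.zero_le], hqw, fun i hi => ?_, fun i hi => ?_, ?_⟩
  · rcases (Nat.lt_succ_iff.1 hi).lt_or_eq with hlt | rfl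
    · rw [hqp i hlt.le, hqp (i + 1) hlt]
      exact htrail i hlt
    · rwa [hqp i le_rfl, hqw]
  · rcases (Nat.lt_succ_iff.1 hi).lt_or_eq with hlt | rfl
    · have hstruct : IsVStructure G (k + 1) q i ↔ IsVStructure G k p i := by
        simp only [IsVStructure, hqp (i - 1) (by omega), hqp i hlt.le, hqp (i + 1) hlt, hlt, hi]
      rw [hstruct, hqp i hlt.le]
      exact hactive i hlt
    · have hstruct : IsVStructure G (i + 1) q i ↔ p i ∈ Z := by
        rw [← hv, ← hinto, IsVStructure, hqp (i - 1) (by omega), hqp i le_rfl, hqw]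
        simp [and_assoc]
      rw [hstruct, hqp i le_rfl]
      exact ⟨id, fun hZ => ⟨p i, hZ, .refl⟩⟩
  · simp [hqp k le_rfl, hqw]

lemma ActiveUpTo.descend (hG : IsAcyclicDigraph G) {u v : V} {into : Prop}
    (h : ActiveUpTo G Z B u into) (huv : Relation.TransGen (FreeArc G Z) u v) :
    ActiveUpTo G Z B v True := by
  have child : ∀ {u v : V} {into : Prop}, ActiveUpTo G Z B u into → FreeArc G Z u v →
      ActiveUpTo G Z B v True := by
    intro u v into h harc
    have := h.step (Or.inl harc.2) (by simp [hG.not_adj_of_adj harc.2, harc.1])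
    rwa [eq_true harc.2] at this
  induction huv with
  | single harc => exact child h harc
  | tail _ harc ih => exact child ih harc

-- The ascent starts as a non-collider outside `Z` or as a v-structure in `Z`.
lemma ActiveUpTo.ascend (hG : IsAcyclicDigraph G) {u v : V} (h : ActiveUpTo G Z B v (v ∈ Z))
    (huv : Relation.TransGen (FreeArc G Z) u v) : ActiveUpTo G Z B u False := by
  have parent : ∀ {u v : V}, ActiveUpTo G Z B v (v ∈ Z) → FreeArc G Z u v →
      ActiveUpTo G Z B u False := by
    intro u v h harc
    have := h.step (Or.inr harc.2) (by simp [harc.2])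
    rwa [eq_false (hG.not_adj_of_adj harc.2)] at this
  induction huv using Relation.TransGen.head_induction_on with
  | single harc => exact parent h harc
  | @head a c harc hcv ih =>
    refine parent ?_ harc
    obtain ⟨_, hstep, -⟩ := Relation.TransGen.head'_iff.1 hcv
    rwa [eq_false hstep.1]

lemma ActiveUpTo.couple (hG : IsAcyclicDigraph G) {u v : V} (h : ActiveUpTo G Z B u False)
    (huv : Coupled G Z u v) : ActiveUpTo G Z B v False := by
  obtain ⟨hu, hv, z, hz, huz, hvz⟩ := huv
  have hcollider := h.descend hG (huz.transGen hu hz)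
  rw [← eq_true hz] at hcollider
  exact hcollider.ascend hG (hvz.transGen hv hz)

lemma not_dSeparates_of_coupled_chain (hG : IsAcyclicDigraph G) {u v : V}
    (hu : u ∈ freeAncestors G Z B) (hv : v ∈ freeAncestors G Z D)
    (huv : Relation.ReflTransGen (Coupled G Z) u v) : ¬ DSeparates G B D Z := by
  obtain ⟨b, ⟨hb, hbZ⟩, hub⟩ := hu
  obtain ⟨d, ⟨hd, hdZ⟩, hvd⟩ := hv
  have hactive_u : ActiveUpTo G Z B u False := by
    have hstart : ActiveUpTo G Z B b False := .refl hb
    rcases Relation.reflTransGen_iff_eq_or_transGen.1 hub with rfl | hub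
    · exact hstart
    · rw [← eq_false hbZ] at hstart
      exact hstart.ascend hG hub
  have hactive_v : ActiveUpTo G Z B v False := by
    clear hvd
    induction huv with
    | refl => exact hactive_u
    | tail _ hcoupled ih => exact ih.couple hG hcoupled
  rcases Relation.reflTransGen_iff_eq_or_transGen.1 hvd with rfl | hvd
  · exact hactive_v.not_dSeparates hd hdZ
  · exact (hactive_v.descend hG hvd).not_dSeparates hd hdZ

lemma dSeparates_iff_separates_moralGraph [Finite V] (hG : IsAcyclicDigraph G) :
    DSeparates G B D Z ↔ Separates (moralGraph G (B ∪ D ∪ Z)) B D Z := by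
  refine ⟨fun hd => ?_, dSeparates_of_separates_moralGraph hG⟩
  by_contra hsep
  obtain ⟨u, hu, v, hv, huv⟩ := exists_coupled_chain_of_not_separates_moralGraph hsep
  exact not_dSeparates_of_coupled_chain hG hu hv huv hd

lemma dSeparates_iff_forall_singleton [Finite V] (hG : IsAcyclicDigraph G) (B D Z : Set V) :
    DSeparates G B D Z ↔ ∀ v ∈ D, DSeparates G B {v} (Z ∪ (D \ {v})) := by
  rw [dSeparates_iff_separates_moralGraph hG, separates_iff_forall_singleton]
  refine forall₂_congr fun v hv => ?_
  have hT : B ∪ {v} ∪ (Z ∪ (D \ {v})) = B ∪ D ∪ Z := by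
    rw [Set.union_comm Z, ← Set.union_assoc, Set.union_assoc B,
      Set.union_sdiff_cancel (Set.singleton_subset_iff.2 hv)]
  rw [dSeparates_iff_separates_moralGraph hG, hT]

variable [Fintype V] {𝒳 : V → Type*} [∀ v, Fintype (𝒳 v)]
  [∀ v, MeasurableSpace (𝒳 v)] [∀ v, DiscreteMeasurableSpace (𝒳 v)]

lemma condIndepSubvectors_of_dSeparates (hG : IsAcyclicDigraph G) (hsep : DSeparates G B D Z)
    (μ : Measure (∀ v, 𝒳 v)) [IsProbabilityMeasure μ] (hμ : FactorizesDirected G μ) :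
    CondIndepSubvectors μ B D Z := by
  classical
  classical
  obtain ⟨p, -, hp, hfactor⟩ := hμ
  obtain ⟨x⟩ := nonempty_of_isProbabilityMeasure μ
  have hnonempty (v : V) : Nonempty (𝒳 v) := ⟨x v⟩
  set T := B ∪ D ∪ Z
  let W : Finset V := (ancestors G T).toFinset
  have hW : (W : Set V) = ancestors G T := Set.coe_toFinset _
  have hTW : T ⊆ W := hW ▸ subset_ancestors T
  refine condIndepSubvectors_of_separates_of_factors
    ((dSeparates_iff_separates_moralGraph hG).1 hsep) μ W (conditionalDensity p)
    (fun v => insert v (parentSet G v)) (∏ v, (Fintype.card (𝒳 v) : ℝ))⁻¹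
    (fun v _ => dependsOn_conditionalDensity v)
    (fun v hv => isClique_moralGraph_family (Set.mem_toFinset.1 hv))
    (fun v hv => hTW (Or.inl (Or.inl hv))) (fun v hv => hTW (Or.inl (Or.inr hv)))
    (fun v hv => hTW (Or.inr hv)) fun F hF => ?_
  simp only [hfactor, prod_conditional_eq, mul_left_comm (F _), ← Finset.mul_sum]
  rw [sum_mul_prod_eq_of_isAncestralSet hG dependsOn_conditionalDensity
    (sum_conditionalDensity_update hG hp) (hW ▸ isAncestralSet_ancestors T) hF
    (fun _ _ _ _ => Finset.mem_univ _) (Finset.subset_univ W)]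

end Moral

/-! ### Dependence in directed graphical models -/

section ChordlessChain

variable {α : Type*} {r : α → α → Prop} {P Q : Set α}

/-- `s 0, …, s k` is a chain of the relation `r` from `P` to `Q` without shortcuts: it meets `P`
and `Q` only at its ends and no element is related to one that lies further ahead than the next
one. -/
structure IsChordlessChain (r : α → α → Prop) (P Q : Set α) (k : ℕ) (s : ℕ → α) : Prop where
  zero_mem : s 0 ∈ P
  last_mem : s k ∈ Q
  rel_succ : ∀ i < k, r (s i) (s (i + 1))
  eq_zero_of_mem : ∀ i ≤ k, s i ∈ P → i = 0
  eq_last_of_mem : ∀ i ≤ k, s i ∈ Q → i = k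
  le_succ_of_rel : ∀ i ≤ k, ∀ j ≤ k, r (s i) (s j) → j ≤ i + 1

lemma exists_chain_of_reflTransGen {x y : α} (h : Relation.ReflTransGen r x y) :
    ∃ (k : ℕ) (s : ℕ → α), s 0 = x ∧ s k = y ∧ ∀ i < k, r (s i) (s (i + 1)) := by
  induction h using Relation.ReflTransGen.head_induction_on with
  | refl => exact ⟨0, fun _ => y, rfl, rfl, by simp⟩
  | @head x z hxz _ ih =>
    obtain ⟨k, s, rfl, rfl, hs⟩ := ih
    refine ⟨k + 1, fun n => Nat.casesOn n x s, rfl, rfl, fun i hi => ?_⟩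
    rcases i with _ | i
    · exact hxz
    · exact hs i (by omega)

lemma exists_isChordlessChain {x y : α} (hx : x ∈ P) (hy : y ∈ Q)
    (h : Relation.ReflTransGen r x y) : ∃ k s, IsChordlessChain r P Q k s := by
  classical
  have hchain : ∃ k, ∃ s : ℕ → α, s 0 ∈ P ∧ s k ∈ Q ∧ ∀ i < k, r (s i) (s (i + 1)) := by
    obtain ⟨k, s, rfl, rfl, hs⟩ := exists_chain_of_reflTransGen h
    exact ⟨k, s, hx, hy, hs⟩
  obtain ⟨s, hP, hQ, hs⟩ := Nat.find_spec hchain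
  have hmin : ∀ l, (∃ s : ℕ → α, s 0 ∈ P ∧ s l ∈ Q ∧ ∀ i < l, r (s i) (s (i + 1))) →
      Nat.find hchain ≤ l := fun l => Nat.find_min' hchain
  generalize Nat.find hchain = k at *
  refine ⟨k, s, hP, hQ, hs, fun i hi hiP => ?_, fun i hi hiQ => ?_, fun i hi j hj hij => ?_⟩
  · have := hmin (k - i) ⟨fun n => s (n + i), by simpa using hiP,
      by simpa only [Nat.sub_add_cancel hi] using hQ,
      fun n hn => by simpa only [Nat.add_right_comm] using hs (n + i) (by omega)⟩
    omega
  · exact hi.antisymm (hmin i ⟨s, hP, hiQ, fun n hn => hs n (by omega)⟩)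
  · by_contra! hchord
    obtain ⟨m, rfl⟩ := Nat.exists_eq_add_of_lt hchord
    have := hmin (k - (m + 1)) ⟨fun n => if n ≤ i then s n else s (n + (m + 1)), by simpa using hP,
      by simpa [show ¬ k - (m + 1) ≤ i by omega, show k - (m + 1) + (m + 1) = k by omega] using hQ,
      fun n hn => ?_⟩
    · omega
    · rcases lt_trichotomy n i with hlt | rfl | hgt
      · simpa [hlt.le, hlt] using hs n (by omega)
      · simpa [Nat.add_right_comm, Nat.add_assoc, Nat.add_comm 1] using hij
      · simpa [hgt.not_ge, show ¬ n + 1 ≤ i by omega, Nat.add_right_comm] using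
          hs (n + (m + 1)) (by omega)

end ChordlessChain

section CoupledChain

variable {V : Type*} {G : Digraph V} {B D Z : Set V}

lemma Coupled.symm {u v : V} (h : Coupled G Z u v) : Coupled G Z v u :=
  ⟨h.2.1, h.1, h.2.2.imp fun _ ⟨hz, hu, hv⟩ => ⟨hz, hv, hu⟩⟩

lemma Coupled.of_freeDescent {u v w : V} (h : Coupled G Z v w) (huv : FreeDescent G Z u v) :
    Coupled G Z u w :=
  ⟨huv.notMem h.1, h.2.1, h.2.2.imp fun _ ⟨hz, hv, hw⟩ => ⟨hz, huv.trans hv, hw⟩⟩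

lemma mem_freeAncestors_of_freeDescent {u v : V} (hv : v ∈ freeAncestors G Z B)
    (huv : FreeDescent G Z u v) : u ∈ freeAncestors G Z B :=
  hv.imp fun _ ⟨hw, hvw⟩ => ⟨hw, huv.trans hvw⟩

namespace IsChordlessChain

variable {k : ℕ} {s : ℕ → V}
  (h : IsChordlessChain (Coupled G Z) (freeAncestors G Z B) (freeAncestors G Z D) k s)

include h

lemma notMem {i : ℕ} (hi : i ≤ k) : s i ∉ Z := by
  rcases hi.lt_or_eq with hlt | rfl
  · exact (h.rel_succ i hlt).1
  · obtain ⟨d, hd, hid⟩ := h.last_mem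
    exact hid.notMem hd.2

lemma eq_of_freeDescent {i j : ℕ} (hi : i ≤ k) (hj : j ≤ k) (hji : FreeDescent G Z (s j) (s i)) :
    j = i := by
  have hij : j ≤ i := by
    rcases Nat.eq_zero_or_pos i with rfl | hpos
    · exact (h.eq_zero_of_mem j hj (mem_freeAncestors_of_freeDescent h.zero_mem hji)).le
    · have hprev := h.rel_succ (i - 1) (by omega)
      rw [Nat.sub_add_cancel hpos] at hprev
      have := h.le_succ_of_rel (i - 1) (by omega) j hj (hprev.symm.of_freeDescent hji).symm
      omega
  rcases hi.lt_or_eq with hlt | rfl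
  · have := h.le_succ_of_rel j hj (i + 1) hlt ((h.rel_succ i hlt).of_freeDescent hji)
    omega
  · exact h.eq_last_of_mem j hj (mem_freeAncestors_of_freeDescent h.last_mem hji)

lemma isAntichain : IsAntichain (FreeDescent G Z) (s '' Set.Iic k) := by
  rintro _ ⟨j, hj, rfl⟩ _ ⟨i, hi, rfl⟩ hne hji
  exact hne (congrArg s (h.eq_of_freeDescent hi hj hji))

lemma eq_or_eq_of_freeDescent {i j : ℕ} (hi : i < k) (hj : j ≤ k) {z : V} (hz : z ∈ Z)
    (hiz : FreeDescent G Z (s i) z) (hsucc : FreeDescent G Z (s (i + 1)) z)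
    (hjz : FreeDescent G Z (s j) z) : j = i ∨ j = i + 1 := by
  have hjZ := h.notMem hj
  have := h.le_succ_of_rel i hi.le j hj ⟨h.notMem hi.le, hjZ, z, hz, hiz, hjz⟩
  have := h.le_succ_of_rel j hj (i + 1) hi ⟨hjZ, h.notMem hi, z, hz, hjz, hsucc⟩
  omega

end IsChordlessChain

end CoupledChain

section SourceModel

variable {V : Type*} {G : Digraph V} {S Z : Set V}

/-- Exactly one vertex of `S` is joined to `v` by a directed path whose vertices, including `v`,
lie outside `Z`. -/
def HasUniqueSource (G : Digraph V) (Z S : Set V) (v : V) : Prop :=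
  v ∉ Z ∧ ∃! s, s ∈ S ∧ FreeDescent G Z s v

lemma HasUniqueSource.of_parent {s u v : V} (hv : HasUniqueSource G Z S v) (hs : s ∈ S)
    (hsu : FreeDescent G Z s u) (huv : FreeArc G Z u v) : HasUniqueSource G Z S u :=
  ⟨huv.1, s, ⟨hs, hsu⟩, fun _ hr => hv.2.unique ⟨hr.1, hr.2.tail huv⟩ ⟨hs, hsu.tail huv⟩⟩

lemma FreeDescent.exists_parent {s v : V} (h : FreeDescent G Z s v) (hne : s ≠ v) :
    ∃ u, FreeDescent G Z s u ∧ FreeArc G Z u v :=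
  (Relation.ReflTransGen.cases_tail h).resolve_left hne.symm

variable {𝒳 : V → Type*}

/-- Whether a vertex `v`, whose parents have the values `y`, takes the value `e v` in the model
`sourceModel`. A vertex with a unique source copies it; any other vertex detects two sources that
disagree, directly or by passing on the detection of a parent. -/
def Signals (G : Digraph V) (Z S : Set V) (e : ∀ v, 𝒳 v) (v : V)
    (y : ∀ u : parentSet G v, 𝒳 u) : Prop :=
  (HasUniqueSource G Z S v ∧ ∃ u : parentSet G v, HasUniqueSource G Z S u ∧ y u = e u) ∨
  (¬ HasUniqueSource G Z S v ∧
    ((∃ u : parentSet G v, (u : V) ∉ Z ∧ ¬ HasUniqueSource G Z S u ∧ y u = e u) ∨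
      ∃ u u' : parentSet G v, HasUniqueSource G Z S u ∧ HasUniqueSource G Z S u' ∧
        y u = e u ∧ y u' ≠ e u'))

/-- The values that a vertex can take, given those of its parents, in a model where the vertices of
`S` are arbitrary and every other vertex `v` equals `e v` if it signals and `o v` if it does not. -/
def sourceModel (G : Digraph V) (Z S : Set V) (e o : ∀ v, 𝒳 v) (v : V)
    (y : ∀ u : parentSet G v, 𝒳 u) : Set (𝒳 v) :=
  {a | v ∉ S → (Signals G Z S e v y ∧ a = e v) ∨ (¬ Signals G Z S e v y ∧ a = o v)}

/-- The configurations of positive probability in the model `sourceModel`. -/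
def IsAdmissible (G : Digraph V) (Z S : Set V) (e o x : ∀ v, 𝒳 v) : Prop :=
  ∀ v, x v ∈ sourceModel G Z S e o v ((parentSet G v).domRestrict x)

variable {e o x : ∀ v, 𝒳 v}

lemma sourceModel_nonempty (v : V) (y : ∀ u : parentSet G v, 𝒳 u) :
    (sourceModel G Z S e o v y).Nonempty := by
  by_cases h : Signals G Z S e v y
  · exact ⟨e v, fun _ => Or.inl ⟨h, rfl⟩⟩
  · exact ⟨o v, fun _ => Or.inr ⟨h, rfl⟩⟩

lemma IsAdmissible.eq_iff_signals (hx : IsAdmissible G Z S e o x) (heo : ∀ v, e v ≠ o v) {v : V}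
    (hv : v ∉ S) : x v = e v ↔ Signals G Z S e v ((parentSet G v).domRestrict x) := by
  rcases hx v hv with ⟨h, hxv⟩ | ⟨h, hxv⟩
  · exact iff_of_true hxv h
  · exact iff_of_false (hxv ▸ (heo v).symm) h

lemma isAdmissible_default (heo : ∀ v, e v ≠ o v) : IsAdmissible G Z S e o o := by
  refine fun v _ => Or.inr ⟨?_, rfl⟩
  rintro (⟨-, u, -, hu⟩ | ⟨-, ⟨u, -, -, hu⟩ | ⟨u, -, -, -, hu, -⟩⟩) <;> exact heo u hu.symm

open scoped Classical in
lemma isAdmissible_piecewise (heo : ∀ v, e v ≠ o v) :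
    IsAdmissible G Z S e o ({v | HasUniqueSource G Z S v}.piecewise e o) := by
  set x := {v | HasUniqueSource G Z S v}.piecewise e o
  have hx : ∀ {v}, HasUniqueSource G Z S v → x v = e v := fun h => Set.piecewise_eq_of_mem _ _ _ h
  have hx' : ∀ {v}, ¬ HasUniqueSource G Z S v → x v = o v :=
    fun h => Set.piecewise_eq_of_notMem _ _ _ h
  intro v hvS
  by_cases hv : HasUniqueSource G Z S v
  · refine Or.inl ⟨Or.inl ⟨hv, ?_⟩, hx hv⟩
    obtain ⟨s, ⟨hs, hsv⟩, -⟩ := hv.2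
    obtain ⟨u, hsu, huv⟩ := hsv.exists_parent (ne_of_mem_of_not_mem hs hvS)
    exact ⟨⟨u, huv.2⟩, hv.of_parent hs hsu huv, hx (hv.of_parent hs hsu huv)⟩
  · refine Or.inr ⟨?_, hx' hv⟩
    rintro (⟨hv', -⟩ | ⟨-, ⟨u, -, hu, hxu⟩ | ⟨-, u', -, hu', -, hxu'⟩⟩)
    · exact hv hv'
    · exact heo u (hxu.symm.trans (hx' hu))
    · exact hxu' (hx hu')

variable [Finite V]

lemma IsAdmissible.eq_iff_of_hasUniqueSource (hG : IsAcyclicDigraph G)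
    (hx : IsAdmissible G Z S e o x) (hS : IsAntichain (FreeDescent G Z) S)
    (heo : ∀ v, e v ≠ o v) {s : V} (hs : s ∈ S) {v : V} (hv : HasUniqueSource G Z S v)
    (hsv : FreeDescent G Z s v) : x v = e v ↔ x s = e s := by
  induction v using hG.wellFounded_adj.induction with
  | _ v ih =>
    by_cases hvS : v ∈ S
    · rw [hS.eq hs hvS hsv]
    rw [hx.eq_iff_signals heo hvS]
    constructor
    · rintro (⟨-, u, hu, hxu⟩ | ⟨hv', -⟩)
      · obtain ⟨r, ⟨hr, hru⟩, -⟩ := hu.2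
        obtain rfl := hv.2.unique ⟨hr, hru.tail ⟨hu.1, u.2⟩⟩ ⟨hs, hsv⟩
        exact (ih u u.2 hu hru).1 hxu
      · exact absurd hv hv'
    · intro hxs
      obtain ⟨u, hsu, huv⟩ := hsv.exists_parent (ne_of_mem_of_not_mem hs hvS)
      have hu := hv.of_parent hs hsu huv
      exact Or.inl ⟨hv, ⟨u, huv.2⟩, hu, (ih u huv.2 hu hsu).2 hxs⟩

lemma IsAdmissible.eq_of_disagreeing_sources (hG : IsAcyclicDigraph G)
    (hx : IsAdmissible G Z S e o x) (hS : IsAntichain (FreeDescent G Z) S)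
    (heo : ∀ v, e v ≠ o v) {r s : V} (hr : r ∈ S) (hs : s ∈ S) (hxr : x r = e r)
    (hxs : x s ≠ e s) {v : V} (hrv : FreeDescent G Z r v) (hsv : FreeDescent G Z s v)
    (honly : ∀ q ∈ S, FreeDescent G Z q v → q = r ∨ q = s) : x v = e v := by
  have hrs : r ≠ s := fun h => hxs (h ▸ hxr)
  induction v using hG.wellFounded_adj.induction with
  | _ v ih =>
    have hvS : v ∉ S := fun hv => hrs ((hS.eq hr hv hrv).trans (hS.eq hs hv hsv).symm)
    have hv : ¬ HasUniqueSource G Z S v := fun h => hrs (h.2.unique ⟨hr, hrv⟩ ⟨hs, hsv⟩)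
    have honly_parent : ∀ {u}, FreeArc G Z u v → ∀ q ∈ S, FreeDescent G Z q u → q = r ∨ q = s :=
      fun huv q hq hqu => honly q hq (hqu.tail huv)
    have of_parent : ∀ {u}, FreeArc G Z u v → FreeDescent G Z r u → FreeDescent G Z s u →
        Signals G Z S e v ((parentSet G v).domRestrict x) := fun {u} huv hru hsu =>
      Or.inr ⟨hv, Or.inl ⟨⟨u, huv.2⟩, huv.1, fun h => hrs (h.2.unique ⟨hr, hru⟩ ⟨hs, hsu⟩),
        ih u huv.2 hru hsu (honly_parent huv)⟩⟩
    obtain ⟨u, hru, huv⟩ := hrv.exists_parent (ne_of_mem_of_not_mem hr hvS)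
    obtain ⟨u', hsu', huv'⟩ := hsv.exists_parent (ne_of_mem_of_not_mem hs hvS)
    rw [hx.eq_iff_signals heo hvS]
    by_cases hsu : FreeDescent G Z s u
    · exact of_parent huv hru hsu
    by_cases hru' : FreeDescent G Z r u'
    · exact of_parent huv' hru' hsu'
    have hu : HasUniqueSource G Z S u := ⟨huv.1, r, ⟨hr, hru⟩, fun q hq =>
      (honly_parent huv q hq.1 hq.2).resolve_right fun h => hsu (h ▸ hq.2)⟩
    have hu' : HasUniqueSource G Z S u' := ⟨huv'.1, s, ⟨hs, hsu'⟩, fun q hq =>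
      (honly_parent huv' q hq.1 hq.2).resolve_left fun h => hru' (h ▸ hq.2)⟩
    exact Or.inr ⟨hv, Or.inr ⟨⟨u, huv.2⟩, ⟨u', huv'.2⟩, hu, hu',
      (hx.eq_iff_of_hasUniqueSource hG hS heo hr hu hru).2 hxr,
      mt (hx.eq_iff_of_hasUniqueSource hG hS heo hs hu' hsu').1 hxs⟩⟩

lemma IsAdmissible.eq_iff_eq_of_chain (hG : IsAcyclicDigraph G) {B D : Set V} {k : ℕ} {s : ℕ → V}
    (hs : IsChordlessChain (Coupled G Z) (freeAncestors G Z B) (freeAncestors G Z D) k s)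
    (hx : IsAdmissible G Z (s '' Set.Iic k) e o x) (heo : ∀ v, e v ≠ o v)
    (hxZ : ∀ z ∈ Z, x z = o z) {i : ℕ} (hi : i ≤ k) : x (s 0) = e (s 0) ↔ x (s i) = e (s i) := by
  induction i with
  | zero => rfl
  | succ i ih =>
    rw [ih (by omega)]
    obtain ⟨-, -, z, hz, hiz, hsucc⟩ := hs.rel_succ i hi
    have hmem : ∀ {j}, j ≤ k → s j ∈ s '' Set.Iic k := fun h => Set.mem_image_of_mem s h
    have hxz : x z ≠ e z := hxZ z hz ▸ (heo z).symm
    have honly : ∀ q ∈ s '' Set.Iic k, FreeDescent G Z q z → q = s i ∨ q = s (i + 1) := by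
      rintro _ ⟨j, hj, rfl⟩ hjz
      exact (hs.eq_or_eq_of_freeDescent hi hj hz hiz hsucc hjz).imp (congrArg s) (congrArg s)
    constructor <;> intro hxi <;> by_contra hne
    · exact hxz (hx.eq_of_disagreeing_sources hG hs.isAntichain heo (hmem (by omega)) (hmem hi)
        hxi hne hiz hsucc honly)
    · exact hxz (hx.eq_of_disagreeing_sources hG hs.isAntichain heo (hmem hi) (hmem (by omega))
        hxi hne hsucc hiz fun q hq hqz => (honly q hq hqz).symm)

end SourceModel

section Directed

variable {V : Type*} [Fintype V] {𝒳 : V → Type*} [∀ v, Fintype (𝒳 v)] [∀ v, Nontrivial (𝒳 v)]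
  [∀ v, MeasurableSpace (𝒳 v)] [∀ v, DiscreteMeasurableSpace (𝒳 v)]
  {G : Digraph V} {B D Z : Set V}

open scoped Classical in
lemma not_indepDirected_of_isChordlessChain (hG : IsAcyclicDigraph G) {k : ℕ} {s : ℕ → V}
    (hs : IsChordlessChain (Coupled G Z) (freeAncestors G Z B) (freeAncestors G Z D) k s) :
    ¬ IndepDirected 𝒳 G B D Z := by
  choose e o heo using fun v => exists_pair_ne (𝒳 v)
  obtain ⟨b, ⟨hb, hbZ⟩, hsb⟩ := hs.zero_mem
  obtain ⟨d, ⟨hd, hdZ⟩, hsd⟩ := hs.last_mem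
  set S := s '' Set.Iic k
  have hmem : ∀ {i}, i ≤ k → s i ∈ S := fun h => Set.mem_image_of_mem s h
  have hb_source : HasUniqueSource G Z S b := by
    refine ⟨hbZ, s 0, ⟨hmem k.zero_le, hsb⟩, ?_⟩
    rintro _ ⟨⟨i, hi, rfl⟩, hib⟩
    rw [hs.eq_zero_of_mem i hi ⟨b, ⟨hb, hbZ⟩, hib⟩]
  have hd_source : HasUniqueSource G Z S d := by
    refine ⟨hdZ, s k, ⟨hmem le_rfl, hsd⟩, ?_⟩
    rintro _ ⟨⟨i, hi, rfl⟩, hid⟩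
    rw [hs.eq_last_of_mem i hi ⟨d, ⟨hd, hdZ⟩, hid⟩]
  obtain ⟨μ, _, hμ, hμ_ne⟩ := exists_factorizesDirected_of_allowed (𝒳 := 𝒳) hG
    (sourceModel G Z S e o) sourceModel_nonempty
  have hagree : ∀ x ∈ fibre Z o, μ {x} ≠ 0 → (x b = e b ↔ x d = e d) := fun x hxZ hμx => by
    have hx : IsAdmissible G Z S e o x := (hμ_ne x).1 hμx
    rw [hx.eq_iff_of_hasUniqueSource hG hs.isAntichain heo (hmem k.zero_le) hb_source hsb,
      hx.eq_iff_eq_of_chain hG hs heo hxZ le_rfl,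
      ← hx.eq_iff_of_hasUniqueSource hG hs.isAntichain heo (hmem le_rfl) hd_source hsd]
  exact fun hindep => not_condIndepSubvectors_of_eq_iff_eq μ hb hd
    ((hμ_ne o).2 (isAdmissible_default heo)) ((hμ_ne _).2 (isAdmissible_piecewise heo))
    (fun z hz => Set.piecewise_eq_of_notMem _ _ _ fun h => h.1 hz) (heo b).symm
    (Set.piecewise_eq_of_mem _ _ _ hb_source) hagree (hindep μ hμ)

lemma indepDirected_iff_dSeparates (hG : IsAcyclicDigraph G) (B D Z : Set V) :
    IndepDirected 𝒳 G B D Z ↔ DSeparates G B D Z := by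
  refine ⟨fun hindep => ?_, fun hsep μ _ hμ => condIndepSubvectors_of_dSeparates hG hsep μ hμ⟩
  rw [dSeparates_iff_separates_moralGraph hG]
  by_contra hsep
  obtain ⟨u, hu, v, hv, huv⟩ := exists_coupled_chain_of_not_separates_moralGraph hsep
  obtain ⟨k, s, hs⟩ := exists_isChordlessChain hu hv huv
  exact not_indepDirected_of_isChordlessChain hG hs hindep

end Directed

theorem mainTheorem1 {V : Type*} [Fintype V] (𝒳 : V → Type*) [∀ v, Fintype (𝒳 v)]
    [∀ v, Nontrivial (𝒳 v)] [∀ v, MeasurableSpace (𝒳 v)]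
    [∀ v, DiscreteMeasurableSpace (𝒳 v)] (B C E : Set V) :
    (∀ G : SimpleGraph V,
      (∃! M : Set V, IsMarkovBlanketIn (IndepUndirected 𝒳 G) B C E M) ∧
      IsMarkovBlanketIn (IndepUndirected 𝒳 G) B C E
        {v ∈ C \ B | ¬ Separates G B {v} (E ∪ (C \ (B ∪ {v})))}) ∧
    (∀ G : Digraph V, IsAcyclicDigraph G →
      (∃! M : Set V, IsMarkovBlanketIn (IndepDirected 𝒳 G) B C E M) ∧
      IsMarkovBlanketIn (IndepDirected 𝒳 G) B C E
        {v ∈ C \ B | ¬ DSeparates G B {v} (E ∪ (C \ (B ∪ {v})))}) := by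
  refine ⟨fun G => ?_, fun G hG => ?_⟩
  · have hblanket := isMarkovBlanketIn_of_forall_singleton
      (indepUndirected_iff_separates (𝒳 := 𝒳) G) (separates_iff_forall_singleton G) B C E
    exact ⟨hblanket.existsUnique, hblanket⟩
  · have hblanket := isMarkovBlanketIn_of_forall_singleton
      (indepDirected_iff_dSeparates (𝒳 := 𝒳) hG) (dSeparates_iff_forall_singleton hG) B C E
    exact ⟨hblanket.existsUnique, hblanket⟩
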